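/- Let $R$ be a commutative ring in which $2$ is invertible, and let $\mathcal{C}$ be an $R$-linear symmetric monoidal category with symmetry $\sigma$, having all small colimits, with $\otimes$ preserving them in each variable. Let $(\pi,\xi)$ be a parity structure on $\mathcal{C}$: an object $\pi$ with $\sigma_{\pi,\pi}=-\mathrm{id}$ and an isomorphism $\xi:\pi\otimes\pi\cong 1$. An odd map $f:x\to y$ is a morphism $\pi\otimes x\to y$ of $\mathcal{C}$. Odd maps compose with even maps (the morphisms of $\mathcal{C}$) and are tensored with identities in the evident way, and the composite $g\circ f$ of odd maps $f:x\to y$ and $g:y\to z$ is the even map $x\cong\pi\otimes\pi\otimes x\xrightarrow{\mathrm{id}\otimes f}\pi\otimes y\xrightarrow{g} z$, where the isomorphism is given by $\xi^{-1}$. For a commutative monoid $a$ in $\mathcal{C}$ and an odd map $f:a^{\otimes m}\to a$ with $m\ge 1$, let $T(f):a^{\otimes(m+1)}\to a$ be the odd map written in elements as $T(f)(b,a_1,\dots,a_m)=f(a_1,\dots,a_{m-1},b\,a_m)-b\,f(a_1,\dots,a_m)$ (with the symmetry $\sigma$ used to permute factors, in particular to move $b$ past $\pi$). An odd map $\Delta:a\to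 a$ is a differential operator of order $k$ if $T^{k+1}(\Delta)=0$. For an object $A$ let $S^nA$ be the coequalizer of the $S_n$-action on $A^{\otimes n}$, and let $SA=\bigsqcup_{n\ge 0}S^nA$ be the free commutative monoid on $A$. Let $\mathrm{br}:A\otimes A\to A$ and $\delta:A\to A\otimes A$ be odd maps which are symmetric, i.e. $\mathrm{br}\circ\sigma=\mathrm{br}$ and $\sigma\circ\delta=\delta$. Then: (0) There is a unique odd differential operator of order $2$ on $SA$ that vanishes on $S^0A$ and $S^1A$ and is induced on $S^2A$ by $\mathrm{br}$; and there is a unique odd differential operator of order $1$ on $SA$ that vanishes on $S^0A$ and is $A\xrightarrow{\delta}A\otimes A\to S^2A$ on $S^1A= A$. Their sum, denoted $\mathrm{br}+\delta$, is an odd differential operator of order $2$ on $SA$. (1) If $(\mathrm{br}+\delta)^2=0$ on $SA$, then $(A,\mathrm{br},\delta)$ is an odd IBL algebra, that is, $\mathrm{br}$ and $\delta$ are symmetric and $$\mathrm{br}\circ(\mathrm{br}\otimes\mathrm{id})\circ\mathfrak{S}_3=0,\qquad \mathfrak{S}_3\circ(\delta\otimes\mathrm{id})\circ\delta=0,\qquad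 \mathrm{br}\circ\delta=0,$$ $$\delta\circ\mathrm{br}+\mathfrak{S}_2\circ(\mathrm{br}\otimes\mathrm{id})\circ(\mathrm{id}\otimes\sigma)\circ(\delta\otimes\mathrm{id})\circ\mathfrak{S}_2=0,$$ where $\mathfrak{S}_2=\mathrm{id}+\sigma$ and $\mathfrak{S}_3$ is the sum of the three cyclic permutations of the factors of $A^{\otimes 3}$. (2) Conversely, if $(A,\mathrm{br},\delta)$ is an odd IBL algebra and $3$ is not a zero divisor on the $R$-module $\mathcal{C}(A,S^3A)$ (i.e. $3f=0$ implies $f=0$), then $(\mathrm{br}+\delta)^2=0$. -/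

import Mathlib

open CategoryTheory MonoidalCategory Limits

universe v u

namespace OddIBL

section Cocomplete

/-- A monoidal category is ⊗-cocomplete when it has all small colimits and the tensor product
preserves them in each variable. -/
class TensorCocomplete (C : Type u) [Category.{v} C] [MonoidalCategory C] : Prop where
  hasColimits : HasColimits C
  preservesLeft : ∀ X : C, PreservesColimits (tensorLeft X)
  preservesRight : ∀ X : C, PreservesColimits (tensorRight X)

attribute [instance] TensorCocomplete.hasColimits TensorCocomplete.preservesLeft
  TensorCocomplete.preservesRight

end Cocomplete

/-! ### The free commutative monoid on an object -/

section FreeCommMon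

variable {C : Type u} [Category.{v} C] [MonoidalCategory C] [SymmetricCategory C]

/-- Tensor powers `A^{⊗ n}`, bracketed to the left and starting from the unit object. -/
@[reducible] def tpow (A : C) : ℕ → C
  | 0 => 𝟙_ C
  | n + 1 => tpow A n ⊗ A

/-- The endomorphisms of `A^{⊗ n}` by which the elements of the symmetric group act, that is,
the composites of the adjacent transpositions of tensor factors. -/
inductive IsPerm (A : C) : ∀ n : ℕ, (tpow A n ⟶ tpow A n) → Prop
  | id (n : ℕ) : IsPerm A n (𝟙 (tpow A n))
  | comp (n : ℕ) (f g : tpow A n ⟶ tpow A n) : IsPerm A n f → IsPerm A n g → IsPerm A n (f ≫ g)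
  | swapLast (n : ℕ) : IsPerm A (n + 2)
      ((α_ (tpow A n) A A).hom ≫ tpow A n ◁ (β_ A A).hom ≫ (α_ (tpow A n) A A).inv)
  | whisker (n : ℕ) (f : tpow A n ⟶ tpow A n) : IsPerm A n f → IsPerm A (n + 1) (f ▷ A)

variable [TensorCocomplete C]

/-- The action of the symmetric group on `A^{⊗ n}`, as a family of endomorphisms. -/
abbrev permFamily (A : C) (n : ℕ) (f : {f : tpow A n ⟶ tpow A n // IsPerm A n f}) :
    tpow A n ⟶ tpow A n := f.1

instance (A : C) (n : ℕ) : Nonempty {f : tpow A n ⟶ tpow A n // IsPerm A n f} :=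
  ⟨⟨_, IsPerm.id n⟩⟩

/-- The symmetric power `S^n A`: the joint coequalizer of the action of the symmetric group
on `A^{⊗ n}`. -/
noncomputable def symPow (A : C) (n : ℕ) : C := wideCoequalizer (permFamily A n)

/-- The quotient map `A^{⊗ n} ⟶ S^n A`. -/
noncomputable def symPowπ (A : C) (n : ℕ) : tpow A n ⟶ symPow A n :=
  wideCoequalizer.π (permFamily A n)

/-- The underlying object `S A = ∐ S^n A` of the free commutative monoid on `A`. -/
noncomputable def SymObj (A : C) : C := ∐ (fun n : ℕ => symPow A n)

/-- The coproduct inclusion `S^n A ⟶ S A`. -/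
noncomputable def symι (A : C) (n : ℕ) : symPow A n ⟶ SymObj A :=
  Sigma.ι (fun n : ℕ => symPow A n) n

/-- The structural map `A^{⊗ n} ⟶ S^n A ⟶ S A`. -/
noncomputable def inc (A : C) (n : ℕ) : tpow A n ⟶ SymObj A := symPowπ A n ≫ symι A n

theorem perm_inc (A : C) (n : ℕ) (f : tpow A n ⟶ tpow A n) (hf : IsPerm A n f) :
    f ≫ inc A n = inc A n := by
  have h : f ≫ symPowπ A n = 𝟙 _ ≫ symPowπ A n :=
    wideCoequalizer.condition (permFamily A n) ⟨f, hf⟩ ⟨_, IsPerm.id n⟩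
  rw [inc, ← Category.assoc, h, Category.id_comp]

theorem existsUnique_symPow_desc (A Z : C) {W : C} (n : ℕ) (k : Z ⊗ tpow A n ⟶ W)
    (h : ∀ f, IsPerm A n f → Z ◁ f ≫ k = k) :
    ∃! g : Z ⊗ symPow A n ⟶ W, Z ◁ symPowπ A n ≫ g = k := by
  let hc := isColimitOfPreserves (tensorLeft Z) (colimit.isColimit (parallelFamily (permFamily A n)))
  let s : Cocone (parallelFamily (permFamily A n) ⋙ tensorLeft Z) :=
    { pt := W
      ι :=
        { app := fun X => by
            cases X
            · exact k
            · exact k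
          naturality := by
            rintro _ _ (_ | f)
            · simp
            · simpa using h f.1 f.2 } }
  have key (g' : ((tensorLeft Z).mapCocone
      (colimit.cocone (parallelFamily (permFamily A n)))).pt ⟶ s.pt)
      (hg' : ((tensorLeft Z).mapCocone (colimit.cocone (parallelFamily (permFamily A n)))).ι.app
        WalkingParallelFamily.one ≫ g' = s.ι.app WalkingParallelFamily.one) :
      g' = hc.desc s := by
    have h1 := hg'.trans (hc.fac s WalkingParallelFamily.one).symm
    apply hc.hom_ext
    rintro (_ | _)
    · rw [← Cocone.w _ (WalkingParallelFamily.Hom.line ⟨_, IsPerm.id n⟩), Category.assoc,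
        Category.assoc, h1]
    · exact h1
  exact ⟨hc.desc s, hc.fac s WalkingParallelFamily.one, fun g hg => key g hg⟩

/-- Since `⊗` preserves colimits, a map out of `Z ⊗ S A` is a family of invariant maps out of
the objects `Z ⊗ A^{⊗ n}`. -/
theorem existsUnique_sym_desc (A Z : C) {W : C} (k : ∀ n, Z ⊗ tpow A n ⟶ W)
    (h : ∀ n f, IsPerm A n f → Z ◁ f ≫ k n = k n) :
    ∃! g : Z ⊗ SymObj A ⟶ W, ∀ n, Z ◁ inc A n ≫ g = k n := by
  have := preservesSmallestColimits_of_preservesColimits (tensorLeft Z)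
  choose g hg hu using fun n => existsUnique_symPow_desc A Z n (k n) (h n)
  let hc := isColimitOfPreserves (tensorLeft Z)
    (colimit.isColimit (Discrete.functor (fun n : ℕ => symPow A n)))
  let s : Cocone (Discrete.functor (fun n : ℕ => symPow A n) ⋙ tensorLeft Z) :=
    { pt := W
      ι := Discrete.natTrans (fun n => g n.as) }
  let d₀ : Z ⊗ SymObj A ⟶ W := hc.desc s
  have h0 : ∀ n, Z ◁ symι A n ≫ d₀ = g n := fun n => hc.fac s ⟨n⟩
  refine ⟨d₀, fun n => ?_, fun d hd => hc.hom_ext ?_⟩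
  · rw [inc, MonoidalCategory.whiskerLeft_comp, Category.assoc, h0]
    exact hg n
  · rintro ⟨n⟩
    refine Eq.trans ?_ (hc.fac s ⟨n⟩).symm
    refine hu n _ ?_
    have := hd n
    rw [inc, MonoidalCategory.whiskerLeft_comp, Category.assoc] at this
    exact this

/-- The map out of `Z ⊗ S A` given by a family of invariant maps. -/
noncomputable def descLeft (A Z : C) {W : C} (k : ∀ n, Z ⊗ tpow A n ⟶ W)
    (h : ∀ n f, IsPerm A n f → Z ◁ f ≫ k n = k n) : Z ⊗ SymObj A ⟶ W :=
  (existsUnique_sym_desc A Z k h).choose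

theorem descLeft_fac (A Z : C) {W : C} (k : ∀ n, Z ⊗ tpow A n ⟶ W)
    (h : ∀ n f, IsPerm A n f → Z ◁ f ≫ k n = k n) (n : ℕ) :
    Z ◁ inc A n ≫ descLeft A Z k h = k n :=
  (existsUnique_sym_desc A Z k h).choose_spec.1 n

theorem left_hom_ext (A Z : C) {W : C} {f g : Z ⊗ SymObj A ⟶ W}
    (h : ∀ n, Z ◁ inc A n ≫ f = Z ◁ inc A n ≫ g) : f = g :=
  (existsUnique_sym_desc A Z (fun n => Z ◁ inc A n ≫ g) (fun n p hp => by
    rw [← MonoidalCategory.whiskerLeft_comp_assoc, perm_inc A n p hp])).unique h (fun _ => rfl)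

/-- Multiplication by a generator on the right, `S A ⊗ A ⟶ S A`. -/
noncomputable def mulGen (A : C) : SymObj A ⊗ A ⟶ SymObj A :=
  (β_ (SymObj A) A).hom ≫ descLeft A A (fun n => (β_ A (tpow A n)).hom ≫ inc A (n + 1))
    (fun n f hf => by
      rw [BraidedCategory.braiding_naturality_right_assoc]
      congr 1
      exact perm_inc A (n + 1) _ (IsPerm.whisker n f hf))

theorem inc_mulGen (A : C) (n : ℕ) : inc A n ▷ A ≫ mulGen A = inc A (n + 1) := by
  rw [mulGen, BraidedCategory.braiding_naturality_left_assoc, descLeft_fac,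
    ← Category.assoc, SymmetricCategory.symmetry]
  exact Category.id_comp _

theorem right_hom_ext (A Z : C) {W : C} {f g : SymObj A ⊗ Z ⟶ W}
    (h : ∀ n, inc A n ▷ Z ≫ f = inc A n ▷ Z ≫ g) : f = g := by
  rw [← cancel_epi (β_ Z (SymObj A)).hom]
  apply left_hom_ext
  intro n
  rw [BraidedCategory.braiding_naturality_right_assoc,
    BraidedCategory.braiding_naturality_right_assoc, h]

theorem mulGen_swap (A : C) :
    (α_ (SymObj A) A A).hom ≫ SymObj A ◁ (β_ A A).hom ≫ (α_ (SymObj A) A A).inv ≫ mulGen A ▷ A ≫ mulGen A =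
      mulGen A ▷ A ≫ mulGen A := by
  rw [← cancel_epi (α_ (SymObj A) A A).inv]
  apply right_hom_ext
  intro n
  have h := perm_inc A (n + 2) _ (IsPerm.swapLast n)
  rw [← inc_mulGen A (n + 1), ← inc_mulGen A n, MonoidalCategory.comp_whiskerRight] at h
  have h' := congrArg (fun t => (α_ (tpow A n) A A).inv ≫ t) h
  simp only [Category.assoc, Iso.inv_hom_id_assoc] at h' ⊢
  rw [← whisker_exchange_assoc, MonoidalCategory.associator_inv_naturality_left_assoc]
  exact h'

/-- Multiplication of an element of `S A` by `n` generators. -/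
noncomputable def mulPow (A : C) : ∀ n : ℕ, SymObj A ⊗ tpow A n ⟶ SymObj A
  | 0 => (ρ_ (SymObj A)).hom
  | n + 1 => (α_ (SymObj A) (tpow A n) A).inv ≫ mulPow A n ▷ A ≫ mulGen A

theorem mulPow_succ (A : C) (n : ℕ) : mulPow A (n + 1) =
    (α_ (SymObj A) (tpow A n) A).inv ≫ mulPow A n ▷ A ≫ mulGen A := rfl

theorem mulPow_perm (A : C) (n : ℕ) (f : tpow A n ⟶ tpow A n) (hf : IsPerm A n f) :
    SymObj A ◁ f ≫ mulPow A n = mulPow A n := by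
  induction hf with
  | id n => simp
  | comp n f g _ _ hf hg => rw [MonoidalCategory.whiskerLeft_comp, Category.assoc, hg, hf]
  | swapLast n =>
    have h := congrArg (fun t => (mulPow A n ▷ A) ▷ A ≫ t) (mulGen_swap A)
    rw [MonoidalCategory.associator_naturality_left_assoc,
      ← whisker_exchange_assoc, MonoidalCategory.associator_inv_naturality_left_assoc] at h
    rw [mulPow_succ, mulPow_succ]
    simp only [MonoidalCategory.comp_whiskerRight, Category.assoc]
    conv_rhs => rw [← h]
    simp only [← Category.assoc]
    congr 3
    monoidal
  | whisker n f _ hf =>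
    rw [mulPow_succ, MonoidalCategory.associator_inv_naturality_middle_assoc,
      ← MonoidalCategory.comp_whiskerRight_assoc, hf]

/-- The multiplication `S A ⊗ S A ⟶ S A`, induced by concatenation of tensors. -/
noncomputable def symMul (A : C) : SymObj A ⊗ SymObj A ⟶ SymObj A :=
  descLeft A (SymObj A) (mulPow A) (mulPow_perm A)

theorem inc_symMul (A : C) (n : ℕ) : SymObj A ◁ inc A n ≫ symMul A = mulPow A n :=
  descLeft_fac ..

theorem mid_hom_ext (A X Z : C) {W : C} {f g : (X ⊗ SymObj A) ⊗ Z ⟶ W}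
    (h : ∀ n, (X ◁ inc A n) ▷ Z ≫ f = (X ◁ inc A n) ▷ Z ≫ g) : f = g := by
  rw [← cancel_epi (β_ Z (X ⊗ SymObj A)).hom, ← cancel_epi (α_ Z X (SymObj A)).hom]
  apply left_hom_ext
  intro n
  rw [MonoidalCategory.associator_naturality_right_assoc,
    MonoidalCategory.associator_naturality_right_assoc,
    BraidedCategory.braiding_naturality_right_assoc,
    BraidedCategory.braiding_naturality_right_assoc, h]

theorem inc_zero_mulPow (A : C) (n : ℕ) :
    inc A 0 ▷ tpow A n ≫ mulPow A n = (λ_ (tpow A n)).hom ≫ inc A n := by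
  induction n with
  | zero =>
    change inc A 0 ▷ 𝟙_ C ≫ (ρ_ (SymObj A)).hom = _
    rw [rightUnitor_naturality, unitors_equal]
  | succ n ih =>
    rw [mulPow_succ, MonoidalCategory.associator_inv_naturality_left_assoc,
      ← MonoidalCategory.comp_whiskerRight_assoc, ih, MonoidalCategory.comp_whiskerRight,
      Category.assoc, inc_mulGen]
    simp

theorem mulGen_symMul (A : C) : SymObj A ◁ mulGen A ≫ symMul A =
    (α_ (SymObj A) (SymObj A) A).inv ≫ symMul A ▷ A ≫ mulGen A := by
  rw [← cancel_epi (α_ (SymObj A) (SymObj A) A).hom, Iso.hom_inv_id_assoc]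
  apply mid_hom_ext
  intro n
  rw [MonoidalCategory.associator_naturality_middle_assoc,
    ← MonoidalCategory.whiskerLeft_comp_assoc, inc_mulGen, inc_symMul,
    ← MonoidalCategory.comp_whiskerRight_assoc, inc_symMul, mulPow_succ, Iso.hom_inv_id_assoc]

theorem symMul_mulPow (A : C) (n : ℕ) : symMul A ▷ tpow A n ≫ mulPow A n =
    (α_ (SymObj A) (SymObj A) (tpow A n)).hom ≫ SymObj A ◁ mulPow A n ≫ symMul A := by
  induction n with
  | zero =>
    change symMul A ▷ 𝟙_ C ≫ (ρ_ (SymObj A)).hom =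
      (α_ (SymObj A) (SymObj A) (𝟙_ C)).hom ≫ SymObj A ◁ (ρ_ (SymObj A)).hom ≫ symMul A
    rw [rightUnitor_naturality]
    simp
  | succ n ih =>
    rw [mulPow_succ, MonoidalCategory.associator_inv_naturality_left_assoc,
      ← MonoidalCategory.comp_whiskerRight_assoc, ih]
    simp only [MonoidalCategory.whiskerLeft_comp, MonoidalCategory.comp_whiskerRight,
      Category.assoc, mulGen_symMul]
    rw [MonoidalCategory.associator_inv_naturality_middle_assoc]
    monoidal

theorem mulGen_mulPow (A : C) (n : ℕ) : mulGen A ▷ tpow A n ≫ mulPow A n =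
    (α_ (SymObj A) A (tpow A n)).hom ≫ SymObj A ◁ (β_ A (tpow A n)).hom ≫
      (α_ (SymObj A) (tpow A n) A).inv ≫ mulPow A n ▷ A ≫ mulGen A := by
  induction n with
  | zero =>
    change mulGen A ▷ 𝟙_ C ≫ (ρ_ (SymObj A)).hom = (α_ (SymObj A) A (𝟙_ C)).hom ≫
      SymObj A ◁ (β_ A (𝟙_ C)).hom ≫ (α_ (SymObj A) (𝟙_ C) A).inv ≫ (ρ_ (SymObj A)).hom ▷ A ≫ mulGen A
    rw [rightUnitor_naturality, braiding_tensorUnit_right]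
    simp
  | succ n ih =>
    have h := congrArg (fun t => (mulPow A n ▷ A) ▷ A ≫ t) (mulGen_swap A)
    rw [MonoidalCategory.associator_naturality_left_assoc,
      ← whisker_exchange_assoc, MonoidalCategory.associator_inv_naturality_left_assoc] at h
    rw [mulPow_succ, MonoidalCategory.associator_inv_naturality_left_assoc,
      ← MonoidalCategory.comp_whiskerRight_assoc, ih]
    simp only [MonoidalCategory.comp_whiskerRight, Category.assoc]
    conv_lhs => rw [← h]
    rw [BraidedCategory.braiding_tensor_right_hom]
    monoidal

theorem inc_symMul_left (A : C) (n : ℕ) :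
    inc A n ▷ SymObj A ≫ symMul A = (β_ (tpow A n) (SymObj A)).hom ≫ mulPow A n := by
  induction n with
  | zero =>
    apply left_hom_ext
    intro n
    rw [whisker_exchange_assoc, inc_symMul, inc_zero_mulPow]
    change _ = _ ≫ (β_ (𝟙_ C) (SymObj A)).hom ≫ (ρ_ (SymObj A)).hom
    rw [braiding_tensorUnit_left, Category.assoc, Iso.inv_hom_id, Category.comp_id,
      leftUnitor_naturality]
  | succ n ih =>
    have h2 : mulGen A ▷ SymObj A ≫ symMul A = (α_ (SymObj A) A (SymObj A)).hom ≫
        SymObj A ◁ (β_ A (SymObj A)).hom ≫ (α_ (SymObj A) (SymObj A) A).inv ≫ symMul A ▷ A ≫ mulGen A := by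
      apply left_hom_ext
      intro m
      rw [whisker_exchange_assoc, inc_symMul, mulGen_mulPow, ← inc_symMul]
      simp only [MonoidalCategory.comp_whiskerRight, Category.assoc]
      rw [← MonoidalCategory.associator_inv_naturality_middle_assoc,
        ← MonoidalCategory.whiskerLeft_comp_assoc,
        ← BraidedCategory.braiding_naturality_right, MonoidalCategory.whiskerLeft_comp_assoc,
        MonoidalCategory.associator_naturality_right_assoc]
    rw [← inc_mulGen, MonoidalCategory.comp_whiskerRight, Category.assoc, h2,
      MonoidalCategory.associator_naturality_left_assoc, ← whisker_exchange_assoc,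
      MonoidalCategory.associator_inv_naturality_left_assoc,
      ← MonoidalCategory.comp_whiskerRight_assoc, ih, mulPow_succ]
    simp only [MonoidalCategory.comp_whiskerRight, Category.assoc]
    rw [BraidedCategory.braiding_tensor_left_hom]
    simp

/-- `S A` is a monoid, with unit `1 = A^{⊗ 0} ⟶ S A`. -/
noncomputable instance symMonObj (A : C) : MonObj (SymObj A) where
  one := inc A 0
  mul := symMul A
  one_mul := by
    apply left_hom_ext
    intro n
    rw [whisker_exchange_assoc, inc_symMul, inc_zero_mulPow, leftUnitor_naturality]
  mul_one := inc_symMul A 0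
  mul_assoc := by
    apply left_hom_ext
    intro n
    rw [whisker_exchange_assoc, inc_symMul, symMul_mulPow,
      MonoidalCategory.associator_naturality_right_assoc,
      ← MonoidalCategory.whiskerLeft_comp_assoc, inc_symMul]

instance (A : C) : IsCommMonObj (SymObj A) where
  mul_comm := by
    apply right_hom_ext
    intro n
    change _ ≫ _ ≫ symMul A = _ ≫ symMul A
    rw [BraidedCategory.braiding_naturality_left_assoc, inc_symMul, inc_symMul_left]

/-- The canonical map `A ≅ S^1 A ⟶ S A`. -/
noncomputable def gen (A : C) : A ⟶ SymObj A := (λ_ A).inv ≫ inc A 1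

end FreeCommMon

/-! ### Parity structures and odd maps -/

section Parity

variable {C : Type u} [Category.{v} C] [MonoidalCategory C] [SymmetricCategory C] [Preadditive C]

/-- A parity structure: an object `π` whose self-braiding is `-1`, with an isomorphism
`ξ : π ⊗ π ≅ 1`. -/
structure ParityStructure (C : Type u) [Category.{v} C] [MonoidalCategory C]
    [SymmetricCategory C] [Preadditive C] where
  /-- the parity object -/
  π : C
  /-- the parity isomorphism -/
  ξ : π ⊗ π ≅ 𝟙_ C
  braiding_eq : (β_ π π).hom = -𝟙 (π ⊗ π)

variable (P : ParityStructure C)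

/-- Odd maps `x ⟶ y` are the maps `π ⊗ x ⟶ y`. -/
abbrev OddHom (x y : C) : Type v := P.π ⊗ x ⟶ y

variable {P}

/-- The odd composite `g ∘ f` of an even map `f` and an odd map `g`. -/
def OddHom.precomp {x y z : C} (g : OddHom P y z) (f : x ⟶ y) : OddHom P x z :=
  P.π ◁ f ≫ g

/-- The odd composite `g ∘ f` of an odd map `f` and an even map `g`. -/
def OddHom.postcomp {x y z : C} (g : y ⟶ z) (f : OddHom P x y) : OddHom P x z :=
  (f : P.π ⊗ x ⟶ y) ≫ g

/-- The even composite `g ∘ f` of two odd maps: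
`x ≅ (π ⊗ π) ⊗ x ≅ π ⊗ (π ⊗ x) ⟶ π ⊗ y ⟶ z`. -/
def OddHom.comp {x y z : C} (g : OddHom P y z) (f : OddHom P x y) : x ⟶ z :=
  (λ_ x).inv ≫ P.ξ.inv ▷ x ≫ (α_ P.π P.π x).hom ≫ P.π ◁ f ≫ g

/-- The odd map `f ⊗ id` for an odd map `f`. -/
def OddHom.tensorId {x y : C} (f : OddHom P x y) (z : C) : OddHom P (x ⊗ z) (y ⊗ z) :=
  (α_ P.π x z).inv ≫ (f : P.π ⊗ x ⟶ y) ▷ z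

end Parity

/-! ### Odd differential operators on a monoid -/

section DiffOp

variable {C : Type u} [Category.{v} C] [MonoidalCategory C] [SymmetricCategory C]

/-- `a^{⊗ (m + 1)}`, bracketed to the right. -/
@[reducible] def argPow (a : C) : ℕ → C
  | 0 => a
  | m + 1 => a ⊗ argPow a m

/-- The map `a ⊗ a^{⊗ (m + 1)} ⟶ a^{⊗ (m + 1)}` multiplying the first factor into the last. -/
def mulLast (a : C) [MonObj a] : ∀ m : ℕ, a ⊗ argPow a m ⟶ argPow a m
  | 0 => MonObj.mul
  | m + 1 => (α_ a a (argPow a m)).inv ≫ (β_ a a).hom ▷ argPow a m ≫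
      (α_ a a (argPow a m)).hom ≫ a ◁ mulLast a m

variable [Preadditive C] (P : ParityStructure C)

/-- The operator `T`, sending an odd `f : a^{⊗ (m + 1)} ⟶ a` to
`(b, a₀, …, aₘ) ↦ f (a₀, …, b aₘ) - b f (a₀, …, aₘ)`. In the second term the strand `b` is moved
past `π` by the symmetry. -/
def oddT (a : C) [MonObj a] (m : ℕ) (f : OddHom P (argPow a m) a) :
    OddHom P (argPow a (m + 1)) a :=
  P.π ◁ mulLast a m ≫ f -
    (α_ P.π a (argPow a m)).inv ≫ (β_ P.π a).hom ▷ argPow a m ≫ (α_ a P.π (argPow a m)).hom ≫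
      a ◁ f ≫ MonObj.mul

/-- The iterates `T^k (Δ)`. -/
def oddTIter (a : C) [MonObj a] (Δ : OddHom P a a) : ∀ k : ℕ, OddHom P (argPow a k) a
  | 0 => Δ
  | k + 1 => oddT P a k (oddTIter a Δ k)

variable {P}

/-- `Δ` is an odd differential operator of order (at most) `k` when `T^{k+1} (Δ) = 0`. -/
def IsOddDiffOp (k : ℕ) {a : C} [MonObj a] (Δ : OddHom P a a) : Prop :=
  oddTIter P a Δ (k + 1) = 0

end DiffOp

/-! ### Odd involutive Lie bialgebras -/

section IBL

variable {C : Type u} [Category.{v} C] [MonoidalCategory C] [SymmetricCategory C] [Preadditive C]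

/-- The cyclic permutation of three tensor factors. -/
def cyc₃ (A : C) : (A ⊗ A) ⊗ A ⟶ (A ⊗ A) ⊗ A := (α_ A A A).hom ≫ (β_ A (A ⊗ A)).hom

/-- The cyclic symmetriser of three tensor factors. -/
def symm₃ (A : C) : (A ⊗ A) ⊗ A ⟶ (A ⊗ A) ⊗ A := 𝟙 _ + cyc₃ A + cyc₃ A ≫ cyc₃ A

/-- The symmetriser of two tensor factors. -/
def symm₂ (A : C) : A ⊗ A ⟶ A ⊗ A := 𝟙 _ + (β_ A A).hom

/-- The map `id ⊗ σ` on three tensor factors. -/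
def swapLast₃ (A : C) : (A ⊗ A) ⊗ A ⟶ (A ⊗ A) ⊗ A :=
  (α_ A A A).hom ≫ A ◁ (β_ A A).hom ≫ (α_ A A A).inv

variable {P : ParityStructure C}

/-- The odd bracket `br` is symmetric: `br ∘ σ = br`. -/
def IsSymmBracket {A : C} (br : OddHom P (A ⊗ A) A) : Prop :=
  br.precomp (β_ A A).hom = br

/-- The odd cobracket `δ` is symmetric: `σ ∘ δ = δ`. -/
def IsSymmCobracket {A : C} (δ : OddHom P A (A ⊗ A)) : Prop :=
  OddHom.postcomp (β_ A A).hom δ = δ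

/-- `(A, br, δ)` is an odd IBL algebra. -/
structure IsOddIBL {A : C} (br : OddHom P (A ⊗ A) A) (δ : OddHom P A (A ⊗ A)) : Prop where
  symm_br : IsSymmBracket br
  symm_δ : IsSymmCobracket δ
  /-- `br ∘ (br ⊗ id) ∘ 𝔖₃ = 0` -/
  jacobi : symm₃ A ≫ br.comp (br.tensorId A) = 0
  /-- `𝔖₃ ∘ (δ ⊗ id) ∘ δ = 0` -/
  coJacobi : (δ.tensorId A).comp δ ≫ symm₃ A = 0
  /-- `br ∘ δ = 0` -/
  involutivity : br.comp δ = 0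
  /-- `δ ∘ br + 𝔖₂ ∘ (br ⊗ id) ∘ (id ⊗ σ) ∘ (δ ⊗ id) ∘ 𝔖₂ = 0` -/
  cocycle : δ.comp br +
    symm₂ A ≫ ((br.tensorId A).precomp (swapLast₃ A)).comp (δ.tensorId A) ≫ symm₂ A = 0

variable [TensorCocomplete C]

/-- The product of two generators, `A ⊗ A ⟶ S A`. -/
noncomputable def genMul (A : C) : A ⊗ A ⟶ SymObj A := (gen A ⊗ₘ gen A) ≫ MonObj.mul

/-- `D` is the extension of `br : A ⊗ A ⟶ A` to an odd differential operator on `S A`: it has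
order `2`, vanishes on `S^0 A` and `S^1 A`, and is `x y ↦ br (x, y)` on `S^2 A`. -/
structure IsBracketExtension {A : C} (br : OddHom P (A ⊗ A) A)
    (D : OddHom P (SymObj A) (SymObj A)) : Prop where
  diffOp : IsOddDiffOp 2 D
  unit : D.precomp (MonObj.one : 𝟙_ C ⟶ SymObj A) = 0
  gen : D.precomp (gen A) = 0
  genMul : D.precomp (genMul A) = OddHom.postcomp (OddIBL.gen A) br

/-- `D` is the extension of `δ : A ⟶ A ⊗ A` to an odd differential operator on `S A`: it has
order `1`, vanishes on `S^0 A`, and is `A ⟶ A ⊗ A ⟶ S^2 A` on `S^1 A`. -/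
structure IsCobracketExtension {A : C} (δ : OddHom P A (A ⊗ A))
    (D : OddHom P (SymObj A) (SymObj A)) : Prop where
  diffOp : IsOddDiffOp 1 D
  unit : D.precomp (MonObj.one : 𝟙_ C ⟶ SymObj A) = 0
  gen : D.precomp (gen A) = OddHom.postcomp (OddIBL.genMul A) δ

end IBL

end OddIBL

open OddIBL

/-! A generalized element of `X` is a map `K ⟶ X` out of a cocommutative comonoid `K`. The
generalized elements of a commutative monoid form a commutative ring, and an odd endomorphism
together with an odd parameter `e : K ⟶ π` acts on this ring additively, in such a way that `oddT`
becomes the commutator with a multiplication (`act_oddTIter`). Signs enter only because two odd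
parameters anticommute under `ξ` (`pairing_swap`). As `X` is a retract of the comonoid `1 ⊕ X`, and
tests can be tensored (`Tests.tensor`), maps may be compared on pure tensors, and maps out of `S A`
on monomials in generators (`Tests.sym`).

What remains concerns differential operators on commutative rings. An operator of order `k` that
vanishes on monomials of length at most `k` vanishes on all of them (`IsNilOp.eq_zero_of_monomial`),
and a commutator of operators of orders `j` and `k` has order `j + k - 1` (`IsNilOp.commutator`).
Let `B` and `D` be the extensions of `br` and `δ`. With two odd parameters the square of the sum is
`BB + (BD + DB) + DD`. By anticommutation `2BB`, `BD + DB` and `2DD` are commutators, so after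
halving the three parts have orders `3`, `2` and `1`. It therefore suffices to know them on short
monomials: `BB` on length `3` is the Jacobi identity, `BD + DB` gives involutivity on length `1` and
the cocycle condition on length `2`, and `DD` on length `1` is the co-Jacobi identity in `S^3 A`.

For the passage from `S A` back to tensor powers, iterating the de Rham differential yields maps `S
A ⟶ A^{⊗ n}` whose composite with the product of generators is the full symmetrization. On the
symmetric maps in question this is twice the wanted expression for `n = 2` and `n = 3`, so inverting
`2` is enough. In the other direction the cyclic symmetriser becomes multiplication by `3` on `S^3
A`, which is why `3`-torsion has to be excluded there.

Existence of the extensions is a recursion on the length of monomials (`exists_extension`). -/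

namespace OddIBL

/-! ### Differential operators on a commutative ring -/

section RingDiffOp

variable {E : Type*} [CommRing E]

/-- Products of `n` elements of `S`. -/
inductive IsMonomial (S : Set E) : ℕ → E → Prop
  | one : IsMonomial S 0 1
  | mul {n : ℕ} {s x : E} : IsMonomial S n s → x ∈ S → IsMonomial S (n + 1) (s * x)

/-- Multiplication by `b` as an additive endomorphism. -/
def mulOp (b : E) : AddMonoid.End E := AddMonoidHom.mulLeft b

@[simp]
theorem mulOp_apply (b t : E) : mulOp b t = b * t := rfl

section Apply

variable (F G : AddMonoid.End E) (t : E)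

@[simp]
theorem end_mul_apply : (F * G) t = F (G t) := rfl

@[simp]
theorem end_add_apply : (F + G) t = F t + G t := rfl

@[simp]
theorem end_sub_apply : (F - G) t = F t - G t := rfl

@[simp]
theorem end_neg_apply : (-F) t = -F t := rfl

@[simp]
theorem end_zero_apply : (0 : AddMonoid.End E) t = 0 := rfl

end Apply

/-- The commutator of an additive endomorphism with the multiplication by `b`. -/
def adMul (b : E) (F : AddMonoid.End E) : AddMonoid.End E :=
  F * mulOp b - mulOp b * F

@[simp]
theorem adMul_apply (b : E) (F : AddMonoid.End E) (t : E) : adMul b F t = F (b * t) - b * F t := rfl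

/-- The operators all of whose `n`-fold commutators with multiplications vanish; for `n = k + 1`
these are the differential operators of order `k`. -/
def IsNilOp : ℕ → AddMonoid.End E → Prop
  | 0, F => F = 0
  | n + 1, F => ∀ b, IsNilOp n (adMul b F)

theorem adMul_add (b : E) (F G : AddMonoid.End E) : adMul b (F + G) = adMul b F + adMul b G := by
  ext t; simp; ring

theorem adMul_neg (b : E) (F : AddMonoid.End E) : adMul b (-F) = -adMul b F := by
  ext t; simp; ring

theorem adMul_one (F : AddMonoid.End E) : adMul 1 F = 0 := by
  ext t; simp

/-- The Leibniz rule in the multiplier, which reduces conditions on commutators to generators. -/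
theorem adMul_mul (b c : E) (F : AddMonoid.End E) : adMul (b * c) F =
    adMul b F * mulOp c + mulOp b * adMul c F := by
  ext t; simp [mul_assoc, mul_sub]

theorem adMul_commutator (b : E) (F G : AddMonoid.End E) :
    adMul b (F * G - G * F) = (adMul b F * G - G * adMul b F) + (F * adMul b G - adMul b G * F) := by
  simp only [adMul, mul_sub, sub_mul, mul_assoc]
  abel

namespace IsNilOp

theorem zero : ∀ n : ℕ, IsNilOp n (0 : AddMonoid.End E)
  | 0 => rfl
  | n + 1 => fun b => by
    have : adMul b (0 : AddMonoid.End E) = 0 := by ext t; simp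
    rw [this]
    exact zero n

theorem succ {n : ℕ} {F : AddMonoid.End E} (h : IsNilOp n F) : IsNilOp (n + 1) F := by
  induction n generalizing F with
  | zero => rw [show F = 0 from h]; exact zero 1
  | succ n ih => exact fun b => ih (h b)

theorem add {n : ℕ} {F G : AddMonoid.End E} (hF : IsNilOp n F) (hG : IsNilOp n G) :
    IsNilOp n (F + G) := by
  induction n generalizing F G with
  | zero => rw [show F = 0 from hF, show G = 0 from hG, add_zero]; rfl
  | succ n ih => exact fun b => adMul_add b F G ▸ ih (hF b) (hG b)

theorem neg {n : ℕ} {F : AddMonoid.End E} (hF : IsNilOp n F) : IsNilOp n (-F) := by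
  induction n generalizing F with
  | zero => rw [show F = 0 from hF, neg_zero]; rfl
  | succ n ih => exact fun b => adMul_neg b F ▸ ih (hF b)

theorem mulLeft_comp {n : ℕ} {F : AddMonoid.End E} (hF : IsNilOp n F) (c : E) :
    IsNilOp n (mulOp c * F) := by
  induction n generalizing F with
  | zero => rw [show F = 0 from hF, mul_zero]; rfl
  | succ n ih =>
    intro b
    have : adMul b (mulOp c * F) = mulOp c * adMul b F := by
      ext t; simp; ring
    rw [this]
    exact ih (hF b)

theorem comp_mulLeft {n : ℕ} {F : AddMonoid.End E} (hF : IsNilOp n F) (c : E) :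
    IsNilOp n (F * mulOp c) := by
  induction n generalizing F with
  | zero => rw [show F = 0 from hF, zero_mul]; rfl
  | succ n ih =>
    intro b
    have : adMul b (F * mulOp c) = adMul b F * mulOp c := by
      ext t; simp [mul_left_comm]
    rw [this]
    exact ih (hF b)

/-- Operators of order `0` commute with multiplications, so they are multiplications themselves. -/
theorem apply_eq {F : AddMonoid.End E} (hF : IsNilOp 1 F) (t : E) : F t = t * F 1 := by
  have h : adMul t F = 0 := hF t
  have := DFunLike.congr_fun h 1
  rw [adMul_apply, mul_one, end_zero_apply] at this
  exact sub_eq_zero.mp this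

/-- The commutator of operators of orders `j` and `k` has order `j + k - 1`. -/
theorem commutator {n j k : ℕ} {F G : AddMonoid.End E} (hF : IsNilOp j F) (hG : IsNilOp k G)
    (h : j + k ≤ n + 2) : IsNilOp n (F * G - G * F) := by
  induction n generalizing j k F G with
  | zero =>
    match j, k with
    | 0, _ => rw [show F = 0 from hF, zero_mul, mul_zero, sub_zero]; rfl
    | _, 0 => rw [show G = 0 from hG, zero_mul, mul_zero, sub_zero]; rfl
    -- Two operators of order `0` are multiplications by ring elements, and these commute.
    | 1, 1 =>
      change _ = _
      ext t
      change F (G t) - G (F t) = 0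
      rw [hG.apply_eq t, hF.apply_eq t, hF.apply_eq, hG.apply_eq (_ * _)]
      ring
    | 1, k + 2 => omega
    | j + 2, k + 1 => omega
  | succ n ih =>
    intro b
    rw [adMul_commutator]
    match j, k with
    | 0, _ =>
      rw [show F = 0 from hF, show adMul b (0 : AddMonoid.End E) = 0 from zero 1 b]
      simp only [zero_mul, mul_zero, sub_zero, add_zero]
      exact zero n
    | _, 0 =>
      rw [show G = 0 from hG, show adMul b (0 : AddMonoid.End E) = 0 from zero 1 b]
      simp only [zero_mul, mul_zero, sub_zero, add_zero]
      exact zero n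
    -- The commutator with `b` is a derivation of the commutator bracket, so each summand has one of
    -- the two orders lowered by one.
    | j + 1, k + 1 => exact (ih (hF b) hG (by omega)).add (ih hF (hG b) (by omega))

/-- By the Leibniz rule of `adMul_mul`, since composing with multiplications does not raise the
order. -/
theorem adMul_monomial {S : Set E} {n : ℕ} {F : AddMonoid.End E}
    (h : ∀ x ∈ S, IsNilOp n (adMul x F)) {m : ℕ} {s : E} (hs : IsMonomial S m s) :
    IsNilOp n (adMul s F) := by
  induction hs with
  | one => rw [adMul_one]; exact zero n
  | mul _ hx ih => rw [adMul_mul]; exact (ih.comp_mulLeft _).add ((h _ hx).mulLeft_comp _)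

/-- A differential operator of order `k` which vanishes on the products of at most `k`
generators vanishes on all products of generators. -/
theorem eq_zero_of_monomial {S : Set E} {k : ℕ} {F : AddMonoid.End E} (hF : IsNilOp (k + 1) F)
    (h : ∀ n ≤ k, ∀ s, IsMonomial S n s → F s = 0) {n : ℕ} {s : E} (hs : IsMonomial S n s) :
    F s = 0 := by
  induction k generalizing F n s with
  | zero => rw [hF.apply_eq, h 0 le_rfl 1 .one, mul_zero]
  | succ k ih =>
    induction hs with
    | one => exact h 0 (Nat.zero_le _) 1 .one
    | @mul n s x hs hx ihs =>
      -- The commutator has order one less and still vanishes on short monomials, because its value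
      -- at `t` involves only `F` at `t` and at `t * x`.
      have h1 : adMul x F s = 0 := ih (hF x) (fun m hm t ht => by
        rw [adMul_apply, h m (by omega) t ht, mul_comm x, h (m + 1) (by omega) _ (ht.mul hx)]
        simp) hs
      rwa [adMul_apply, ihs, mul_zero, sub_zero, mul_comm] at h1

end IsNilOp

/-- Iterated commutators with multiplications. -/
def adMulList : List E → AddMonoid.End E → AddMonoid.End E
  | [], F => F
  | b :: l, F => adMul b (adMulList l F)

theorem adMulList_concat (l : List E) (b : E) (F : AddMonoid.End E) :
    adMulList (l ++ [b]) F = adMulList l (adMul b F) := by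
  induction l with
  | nil => rfl
  | cons c l ih => rw [List.cons_append, adMulList, adMulList, ih]

/-- `IsNilOp` takes the innermost commutator first, whereas the head of the list in `adMulList` is
outermost, as in `oddTIter`. The induction therefore splits off the last entry. -/
theorem isNilOp_iff (n : ℕ) (F : AddMonoid.End E) :
    IsNilOp n F ↔ ∀ l : List E, l.length = n → adMulList l F = 0 := by
  induction n generalizing F with
  | zero => simp [IsNilOp, adMulList]
  | succ n ih =>
    simp only [IsNilOp, ih]
    constructor
    · intro h l hl
      obtain rfl | ⟨l, b, rfl⟩ := l.eq_nil_or_concat'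
      · simp at hl
      · rw [adMulList_concat]
        exact h b l (by simpa using hl)
    · intro h b l hl
      rw [← adMulList_concat]
      exact h _ (by simp [hl])

end RingDiffOp
end OddIBL

namespace OddIBL

/-! ### Generalized elements over cocommutative comonoids. -/

section Points

set_option linter.unusedSectionVars false

variable {C : Type u} [Category.{v} C] [MonoidalCategory C] [SymmetricCategory C]

open scoped ComonObj MonObj

/-- The tensor product of two generalized elements of stage `K`. -/
def tmul {K X Y : C} [ComonObj K] (x : K ⟶ X) (y : K ⟶ Y) : K ⟶ X ⊗ Y := Δ[K] ≫ (x ⊗ₘ y)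

infixr:85 " ⊠ " => tmul

section

variable {K : C} [ComonObj K] {X Y Z X' Y' W : C}

@[simp]
theorem tmul_tensorHom (x : K ⟶ X) (y : K ⟶ Y) (f : X ⟶ X') (g : Y ⟶ Y') :
    x ⊠ y ≫ (f ⊗ₘ g) = (x ≫ f) ⊠ (y ≫ g) := by
  simp [tmul]

@[simp]
theorem tmul_tensorHom_assoc (x : K ⟶ X) (y : K ⟶ Y) (f : X ⟶ X') (g : Y ⟶ Y')
    (h : X' ⊗ Y' ⟶ W) : x ⊠ y ≫ (f ⊗ₘ g) ≫ h = (x ≫ f) ⊠ (y ≫ g) ≫ h := by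
  rw [← Category.assoc, tmul_tensorHom]

@[simp]
theorem tmul_whiskerLeft (x : K ⟶ X) (y : K ⟶ Y) (g : Y ⟶ Y') :
    x ⊠ y ≫ X ◁ g = x ⊠ (y ≫ g) := by
  simp [← id_tensorHom]

@[simp]
theorem tmul_whiskerLeft_assoc (x : K ⟶ X) (y : K ⟶ Y) (g : Y ⟶ Y') (h : X ⊗ Y' ⟶ W) :
    x ⊠ y ≫ X ◁ g ≫ h = x ⊠ (y ≫ g) ≫ h := by
  rw [← Category.assoc, tmul_whiskerLeft]

@[simp]
theorem tmul_whiskerRight (x : K ⟶ X) (y : K ⟶ Y) (f : X ⟶ X') :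
    x ⊠ y ≫ f ▷ Y = (x ≫ f) ⊠ y := by
  simp [← tensorHom_id]

@[simp]
theorem tmul_whiskerRight_assoc (x : K ⟶ X) (y : K ⟶ Y) (f : X ⟶ X') (h : X' ⊗ Y ⟶ W) :
    x ⊠ y ≫ f ▷ Y ≫ h = (x ≫ f) ⊠ y ≫ h := by
  rw [← Category.assoc, tmul_whiskerRight]

@[simp]
theorem tmul_associator_hom (x : K ⟶ X) (y : K ⟶ Y) (z : K ⟶ Z) :
    (x ⊠ y) ⊠ z ≫ (α_ X Y Z).hom = x ⊠ (y ⊠ z) := by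
  have h : (x ⊠ y) ⊠ z = Δ[K] ≫ Δ[K] ▷ K ≫ ((x ⊗ₘ y) ⊗ₘ z) := by
    rw [tmul, tmul, ← tensorHom_id, tensorHom_comp_tensorHom, Category.id_comp]
  have h' : x ⊠ (y ⊠ z) = Δ[K] ≫ K ◁ Δ[K] ≫ (x ⊗ₘ (y ⊗ₘ z)) := by
    rw [tmul, tmul, ← id_tensorHom, tensorHom_comp_tensorHom, Category.id_comp]
  rw [h, h', Category.assoc, Category.assoc, associator_naturality, ComonObj.comul_assoc_assoc]

@[simp]
theorem tmul_associator_hom_assoc (x : K ⟶ X) (y : K ⟶ Y) (z : K ⟶ Z) (h : X ⊗ Y ⊗ Z ⟶ W) :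
    (x ⊠ y) ⊠ z ≫ (α_ X Y Z).hom ≫ h = x ⊠ (y ⊠ z) ≫ h := by
  rw [← Category.assoc, tmul_associator_hom]

@[simp]
theorem tmul_associator_inv (x : K ⟶ X) (y : K ⟶ Y) (z : K ⟶ Z) :
    x ⊠ (y ⊠ z) ≫ (α_ X Y Z).inv = (x ⊠ y) ⊠ z := by
  rw [← tmul_associator_hom, Category.assoc, Iso.hom_inv_id, Category.comp_id]

@[simp]
theorem tmul_associator_inv_assoc (x : K ⟶ X) (y : K ⟶ Y) (z : K ⟶ Z) (h : (X ⊗ Y) ⊗ Z ⟶ W) :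
    x ⊠ (y ⊠ z) ≫ (α_ X Y Z).inv ≫ h = (x ⊠ y) ⊠ z ≫ h := by
  rw [← Category.assoc, tmul_associator_inv]

@[simp]
-- Cocommutativity of the stage lets factors be permuted without any sign, even past `π`.
theorem tmul_braiding [IsCommComonObj K] (x : K ⟶ X) (y : K ⟶ Y) :
    x ⊠ y ≫ (β_ X Y).hom = y ⊠ x := by
  rw [tmul, Category.assoc, BraidedCategory.braiding_naturality, IsCommComonObj.comul_comm_assoc,
    tmul]

@[simp]
theorem tmul_braiding_assoc [IsCommComonObj K] (x : K ⟶ X) (y : K ⟶ Y) (h : Y ⊗ X ⟶ W) :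
    x ⊠ y ≫ (β_ X Y).hom ≫ h = y ⊠ x ≫ h := by
  rw [← Category.assoc, tmul_braiding]

theorem tmul_eq_leftUnitor_inv (y : K ⟶ Y) : ε[K] ⊠ y = y ≫ (λ_ Y).inv := by
  rw [tmul, MonoidalCategory.tensorHom_def, ComonObj.counit_comul_assoc, leftUnitor_inv_naturality]

theorem tmul_eq_rightUnitor_inv (y : K ⟶ Y) : y ⊠ ε[K] = y ≫ (ρ_ Y).inv := by
  rw [tmul, MonoidalCategory.tensorHom_def', ComonObj.comul_counit_assoc,
    rightUnitor_inv_naturality]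

@[simp]
theorem counit_tmul_leftUnitor (y : K ⟶ Y) : ε[K] ⊠ y ≫ (λ_ Y).hom = y := by
  simp [tmul_eq_leftUnitor_inv]

@[simp]
theorem tmul_counit_rightUnitor (y : K ⟶ Y) : y ⊠ ε[K] ≫ (ρ_ Y).hom = y := by
  simp [tmul_eq_rightUnitor_inv]

@[simp]
theorem tmul_counit_rightUnitor_assoc (y : K ⟶ Y) (h : Y ⟶ W) :
    y ⊠ ε[K] ≫ (ρ_ Y).hom ≫ h = y ≫ h := by
  rw [← Category.assoc, tmul_counit_rightUnitor]

theorem comp_tmul {L : C} [ComonObj L] (r : L ⟶ K) [IsComonHom r] (x : K ⟶ X) (y : K ⟶ Y) :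
    r ≫ x ⊠ y = (r ≫ x) ⊠ (r ≫ y) := by
  simp [tmul]

section Preadditive

variable [Preadditive C] [MonoidalPreadditive C]

theorem add_tmul (x x' : K ⟶ X) (y : K ⟶ Y) : (x + x') ⊠ y = x ⊠ y + x' ⊠ y := by
  simp [tmul, MonoidalPreadditive.add_tensor]

theorem tmul_add (x : K ⟶ X) (y y' : K ⟶ Y) : x ⊠ (y + y') = x ⊠ y + x ⊠ y' := by
  simp [tmul, MonoidalPreadditive.tensor_add]

@[simp]
theorem zero_tmul (y : K ⟶ Y) : (0 : K ⟶ X) ⊠ y = 0 := by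
  simp [tmul]

@[simp]
theorem tmul_zero (x : K ⟶ X) : x ⊠ (0 : K ⟶ Y) = 0 := by
  simp [tmul]

theorem neg_tmul (x : K ⟶ X) (y : K ⟶ Y) : (-x) ⊠ y = -x ⊠ y := by
  rw [eq_neg_iff_add_eq_zero, ← add_tmul]; simp

/-- The generalized elements of a commutative monoid form a commutative ring. -/
instance pointsCommRing [IsCommComonObj K] (a : C) [MonObj a] [IsCommMonObj a] :
    CommRing (K ⟶ a) where
  __ := (inferInstance : AddCommGroup (K ⟶ a))
  mul x y := x ⊠ y ≫ μ[a]
  one := ε[K] ≫ η[a]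
  left_distrib x y z := by
    change x ⊠ (y + z) ≫ μ[a] = x ⊠ y ≫ μ[a] + x ⊠ z ≫ μ[a]
    rw [tmul_add, Preadditive.add_comp]
  right_distrib x y z := by
    change (x + y) ⊠ z ≫ μ[a] = x ⊠ z ≫ μ[a] + y ⊠ z ≫ μ[a]
    rw [add_tmul, Preadditive.add_comp]
  zero_mul x := by
    change (0 : K ⟶ a) ⊠ x ≫ μ[a] = 0
    simp
  mul_zero x := by
    change x ⊠ (0 : K ⟶ a) ≫ μ[a] = 0
    simp
  mul_assoc x y z := by
    change (x ⊠ y ≫ μ[a]) ⊠ z ≫ μ[a] = x ⊠ (y ⊠ z ≫ μ[a]) ≫ μ[a]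
    rw [← tmul_whiskerRight_assoc, MonObj.mul_assoc, tmul_associator_hom_assoc,
      tmul_whiskerLeft_assoc]
  one_mul x := by
    change (ε[K] ≫ η[a]) ⊠ x ≫ μ[a] = x
    rw [← tmul_whiskerRight_assoc, MonObj.one_mul, counit_tmul_leftUnitor]
  mul_one x := by
    change x ⊠ (ε[K] ≫ η[a]) ≫ μ[a] = x
    rw [← tmul_whiskerLeft_assoc, MonObj.mul_one, tmul_counit_rightUnitor]
  mul_comm x y := by
    change x ⊠ y ≫ μ[a] = y ⊠ x ≫ μ[a]
    rw [← tmul_braiding x y, Category.assoc, IsCommMonObj.mul_comm]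

theorem points_mul_def [IsCommComonObj K] {a : C} [MonObj a] [IsCommMonObj a] (x y : K ⟶ a) :
    x ⊠ y ≫ μ[a] = x * y := rfl

theorem points_one_def [IsCommComonObj K] {a : C} [MonObj a] [IsCommMonObj a] :
    ε[K] ≫ η[a] = (1 : K ⟶ a) := rfl

theorem comp_mul {L : C} [ComonObj L] [IsCommComonObj K] [IsCommComonObj L] (r : L ⟶ K)
    [IsComonHom r] {a : C} [MonObj a] [IsCommMonObj a] (x y : K ⟶ a) :
    r ≫ (x * y) = (r ≫ x) * (r ≫ y) := by
  rw [← points_mul_def, ← points_mul_def, ← Category.assoc, comp_tmul]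

theorem comp_one {L : C} [ComonObj L] [IsCommComonObj K] [IsCommComonObj L] (r : L ⟶ K)
    [IsComonHom r] {a : C} [MonObj a] [IsCommMonObj a] : r ≫ (1 : K ⟶ a) = 1 := by
  rw [← points_one_def, ← points_one_def, ← Category.assoc, IsComonHom.hom_counit]

end Preadditive

end

/-! ### Projections from tensor products of comonoids -/

section Projections

variable (K L : C) [ComonObj K] [ComonObj L]

/-- The first projection from a tensor product of comonoids. -/
def comonFst : K ⊗ L ⟶ K := K ◁ ε[L] ≫ (ρ_ K).hom

/-- The second projection from a tensor product of comonoids. -/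
def comonSnd : K ⊗ L ⟶ L := ε[K] ▷ L ≫ (λ_ L).hom

theorem comul_tensor_comp {K₁ K₂ L₁ L₂ : C} (a : K ⟶ K₁) (b : L ⟶ L₁) (c : K ⟶ K₂) (d : L ⟶ L₂) :
    Δ[K ⊗ L] ≫ ((a ⊗ₘ b) ⊗ₘ (c ⊗ₘ d)) = (a ⊠ c ⊗ₘ b ⊠ d) ≫ tensorμ K₁ K₂ L₁ L₂ := by
  rw [Comon.tensorObj_comul, Category.assoc, ← tensorμ_natural, tensorHom_comp_tensorHom_assoc]
  rfl

theorem id_tmul_id : 𝟙 K ⊠ 𝟙 K = Δ[K] := by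
  rw [tmul, id_tensorHom_id, Category.comp_id]

instance : IsComonHom (comonFst K L) where
  hom_counit := by
    rw [Comon.tensorObj_counit, comonFst, MonoidalCategory.tensorHom_def', Category.assoc,
      Category.assoc, ← rightUnitor_naturality, unitors_equal]
  hom_comul := by
    have h := comul_tensor_comp K L (𝟙 K) ε[L] (𝟙 K) ε[L]
    rw [comonFst, ← id_tensorHom, ← tensorHom_comp_tensorHom, reassoc_of% h, id_tmul_id,
      tmul_eq_leftUnitor_inv]
    have h2 : tensorμ K K (𝟙_ C) (𝟙_ C) ≫ ((ρ_ K).hom ⊗ₘ (ρ_ K).hom) =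
        (K ⊗ K) ◁ (λ_ _).hom ≫ (ρ_ (K ⊗ K)).hom := by
      simp only [tensorμ, braiding_tensorUnit_right]
      monoidal
    rw [h2, ← id_tensorHom, tensorHom_comp_tensorHom_assoc, Category.assoc, Category.assoc,
      Iso.inv_hom_id, Category.comp_id, Category.comp_id, id_tensorHom,
      MonoidalCategory.tensorHom_def', Category.assoc, rightUnitor_naturality]

instance : IsComonHom (comonSnd K L) where
  hom_counit := by
    rw [Comon.tensorObj_counit, comonSnd, MonoidalCategory.tensorHom_def, Category.assoc,
      Category.assoc, ← leftUnitor_naturality]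
  hom_comul := by
    have h := comul_tensor_comp K L ε[K] (𝟙 L) ε[K] (𝟙 L)
    rw [comonSnd, ← tensorHom_id, ← tensorHom_comp_tensorHom, reassoc_of% h, id_tmul_id,
      tmul_eq_leftUnitor_inv]
    have h2 : tensorμ (𝟙_ C) (𝟙_ C) L L ≫ ((λ_ L).hom ⊗ₘ (λ_ L).hom) =
        (λ_ _).hom ▷ (L ⊗ L) ≫ (λ_ (L ⊗ L)).hom := by
      simp only [tensorμ, braiding_tensorUnit_left]
      monoidal
    rw [h2, ← tensorHom_id, tensorHom_comp_tensorHom_assoc, Category.assoc, Category.assoc,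
      Iso.inv_hom_id, Category.comp_id, Category.comp_id, tensorHom_id,
      MonoidalCategory.tensorHom_def, Category.assoc, leftUnitor_naturality]

theorem fst_tmul_snd : comonFst K L ⊠ comonSnd K L = 𝟙 (K ⊗ L) := by
  have h := comul_tensor_comp K L (𝟙 K) ε[L] ε[K] (𝟙 L)
  have h2 : tensorμ K (𝟙_ C) (𝟙_ C) L ≫ ((ρ_ K).hom ⊗ₘ (λ_ L).hom) =
      ((ρ_ K).hom ⊗ₘ (λ_ L).hom) := by
    simp only [tensorμ, braiding_tensorUnit_left]
    monoidal
  rw [tmul, comonFst, comonSnd, ← id_tensorHom, ← tensorHom_id, ← tensorHom_comp_tensorHom,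
    reassoc_of% h, tmul_eq_leftUnitor_inv, tmul_eq_rightUnitor_inv, h2, tensorHom_comp_tensorHom]
  simp

/-- Elements with unrelated stages can be moved to the common stage `K ⊗ L` without loss, which is
what allows tests to be tensored. -/
theorem fst_comp_tmul_snd_comp {X Y : C} (x : K ⟶ X) (y : L ⟶ Y) :
    (comonFst K L ≫ x) ⊠ (comonSnd K L ≫ y) = x ⊗ₘ y := by
  rw [← tmul_tensorHom, fst_tmul_snd, Category.id_comp]

end Projections

/-! ### The commutative comonoid `1 ⊕ X` with primitive elements `X` -/

section Primitive

variable [Preadditive C] [MonoidalPreadditive C] [HasBinaryBiproducts C]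

/-- The commutative comonoid `1 ⊕ X` in which `X` is primitive. -/
noncomputable def Prim (X : C) : C := 𝟙_ C ⊞ X

namespace Prim

variable (X : C)

/-- The grouplike summand. -/
noncomputable def inl : 𝟙_ C ⟶ Prim X := biprod.inl

/-- The primitive summand. -/
noncomputable def inr : X ⟶ Prim X := biprod.inr

/-- The tautological generalized element of `X` of stage `1 ⊕ X`. -/
noncomputable def coord : Prim X ⟶ X := biprod.snd

variable {X} in
theorem hom_ext {Y : C} {f g : Prim X ⟶ Y} (h₁ : inl X ≫ f = inl X ≫ g)
    (h₂ : inr X ≫ f = inr X ≫ g) : f = g := biprod.hom_ext' f g h₁ h₂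

@[simp]
-- Every object is thus a retract of a cocommutative comonoid, and the single element `coord X`
-- already distinguishes maps out of `Q ⊗ X`.
theorem inr_coord : inr X ≫ coord X = 𝟙 X := biprod.inr_snd

/-- The comultiplication of `1 ⊕ X`. -/
noncomputable def comul : Prim X ⟶ Prim X ⊗ Prim X :=
  biprod.desc ((λ_ _).inv ≫ (inl X ⊗ₘ inl X))
    ((λ_ _).inv ≫ (inl X ⊗ₘ inr X) + (ρ_ _).inv ≫ (inr X ⊗ₘ inl X))

/-- The counit of `1 ⊕ X`. -/
noncomputable def counit : Prim X ⟶ 𝟙_ C := biprod.fst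

@[simp]
theorem inl_counit : inl X ≫ counit X = 𝟙 _ := biprod.inl_fst

@[simp]
theorem inr_counit : inr X ≫ counit X = 0 := biprod.inr_fst

@[simp]
theorem inl_comul : inl X ≫ comul X = (λ_ _).inv ≫ (inl X ⊗ₘ inl X) := biprod.inl_desc _ _

@[simp]
theorem inr_comul : inr X ≫ comul X =
    (λ_ _).inv ≫ (inl X ⊗ₘ inr X) + (ρ_ _).inv ≫ (inr X ⊗ₘ inl X) := biprod.inr_desc _ _

@[simp]
theorem inl_comul_assoc {Y : C} (h : Prim X ⊗ Prim X ⟶ Y) :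
    inl X ≫ comul X ≫ h = (λ_ _).inv ≫ (inl X ⊗ₘ inl X) ≫ h := by
  rw [← Category.assoc, inl_comul, Category.assoc]

@[simp]
theorem inr_comul_assoc {Y : C} (h : Prim X ⊗ Prim X ⟶ Y) : inr X ≫ comul X ≫ h =
    (λ_ _).inv ≫ (inl X ⊗ₘ inr X) ≫ h + (ρ_ _).inv ≫ (inr X ⊗ₘ inl X) ≫ h := by
  rw [← Category.assoc, inr_comul, Preadditive.add_comp, Category.assoc, Category.assoc]

section Coherence

variable {X} {Y : C} (a b : 𝟙_ C ⟶ Y) (x : X ⟶ Y)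

theorem tensorHom_comp_left {U V W X' Y' : C} (f : U ⟶ V) (g : W ⟶ X') (h : X' ⟶ Y') :
    (f ⊗ₘ g ≫ h) = U ◁ g ≫ (f ⊗ₘ h) := by
  rw [← id_tensorHom, tensorHom_comp_tensorHom, Category.id_comp]

theorem comp_tensorHom_right {U V W X' Y' : C} (f : U ⟶ V) (g : W ⟶ X') (h : X' ⟶ Y') :
    (g ≫ h ⊗ₘ f) = g ▷ U ≫ (h ⊗ₘ f) := by
  rw [← tensorHom_id, tensorHom_comp_tensorHom, Category.id_comp]

/-- This and the next two lemmas are the terms of coassociativity on a primitive element `x`, which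
stands in the third, second and first place respectively. -/
theorem unit_unit_right_assoc : (λ_ X).inv ≫ (a ⊗ₘ (λ_ X).inv ≫ (b ⊗ₘ x)) =
    (λ_ X).inv ≫ ((λ_ (𝟙_ C)).inv ≫ (a ⊗ₘ b) ⊗ₘ x) ≫ (α_ Y Y Y).hom := by
  rw [comp_tensorHom_right, tensorHom_comp_left, Category.assoc, associator_naturality]
  simp only [← Category.assoc]
  congr 1
  monoidal

theorem unit_middle_unit_assoc : (λ_ X).inv ≫ (a ⊗ₘ (ρ_ X).inv ≫ (x ⊗ₘ b)) =
    (ρ_ X).inv ≫ ((λ_ X).inv ≫ (a ⊗ₘ x) ⊗ₘ b) ≫ (α_ Y Y Y).hom := by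
  rw [comp_tensorHom_right, tensorHom_comp_left, Category.assoc, associator_naturality]
  simp only [← Category.assoc]
  congr 1
  monoidal

theorem left_unit_unit_assoc : (ρ_ X).inv ≫ (x ⊗ₘ (λ_ (𝟙_ C)).inv ≫ (a ⊗ₘ b)) =
    (ρ_ X).inv ≫ ((ρ_ X).inv ≫ (x ⊗ₘ a) ⊗ₘ b) ≫ (α_ Y Y Y).hom := by
  rw [comp_tensorHom_right, tensorHom_comp_left, Category.assoc, associator_naturality]
  simp only [← Category.assoc]
  congr 1
  monoidal

end Coherence

noncomputable instance : ComonObj (Prim X) where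
  counit := counit X
  comul := comul X
  counit_comul := by
    apply hom_ext
    · simp [← tensorHom_id]
    · simp [← tensorHom_id]
  comul_counit := by
    apply hom_ext
    · simp [← id_tensorHom, ← unitors_equal]
    · simp [← id_tensorHom]
  comul_assoc := by
    apply hom_ext
    · simpa [← id_tensorHom, ← tensorHom_id] using unit_unit_right_assoc (inl X) (inl X) (inl X)
    · simp [← id_tensorHom, ← tensorHom_id, Preadditive.add_comp, MonoidalPreadditive.add_tensor,
        MonoidalPreadditive.tensor_add, unit_unit_right_assoc, unit_middle_unit_assoc,
        left_unit_unit_assoc, add_assoc]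

instance : IsCommComonObj (Prim X) where
  comul_comm := by
    change comul X ≫ _ = comul X
    apply hom_ext
    · simp [unitors_inv_equal]
    · simp [add_comm]

end Prim

end Primitive

end Points
end OddIBL

namespace OddIBL

/-! ### Families of generalized elements that detect equality of maps. -/

section Tests

set_option linter.unusedSectionVars false

variable {C : Type u} [Category.{v} C] [MonoidalCategory C] [SymmetricCategory C]

open scoped ComonObj MonObj

/-- A class of generalized elements of `X`, stable under projections of the stage, which suffices
to distinguish the maps out of `Q ⊗ X` for all `Q`. -/
structure Tests (X : C) where
  mem : ∀ (K : C) [ComonObj K] [IsCommComonObj K], (K ⟶ X) → Prop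
  pull : ∀ {K L : C} [ComonObj K] [IsCommComonObj K] [ComonObj L] [IsCommComonObj L]
    (r : L ⟶ K) [IsComonHom r] (t : K ⟶ X), mem K t → mem L (r ≫ t)
  detect : ∀ {Q W : C} (f g : Q ⊗ X ⟶ W),
    (∀ (K : C) [ComonObj K] [IsCommComonObj K] (t : K ⟶ X), mem K t →
      Q ◁ t ≫ f = Q ◁ t ≫ g) → f = g

namespace Tests

theorem hom_ext {X W : C} (T : Tests X) {f g : X ⟶ W}
    (h : ∀ (K : C) [ComonObj K] [IsCommComonObj K] (t : K ⟶ X), T.mem K t → t ≫ f = t ≫ g) :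
    f = g := by
  rw [← cancel_epi (λ_ X).hom]
  apply T.detect
  intro K _ _ t ht
  rw [leftUnitor_naturality_assoc, leftUnitor_naturality_assoc, h K t ht]

/-- Pure tensors of test elements are test elements. -/
def tensor {X Y : C} (S : Tests X) (T : Tests Y) : Tests (X ⊗ Y) where
  mem K _ _ w := ∃ x y, S.mem K x ∧ T.mem K y ∧ w = x ⊠ y
  pull := by
    rintro K L _ _ _ _ r _ _ ⟨x, y, hx, hy, rfl⟩
    exact ⟨r ≫ x, r ≫ y, S.pull r x hx, T.pull r y hy, comp_tmul r x y⟩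
  detect := by
    intro Q W f g h
    rw [← cancel_epi (α_ Q X Y).hom]
    apply T.detect
    intro L _ _ y hy
    -- `Y` has been tested with `Q ⊗ X` as parameter object. Moving `X` to the right end turns `Q ⊗
    -- L` into the parameter object for the second test.
    rw [← cancel_epi (α_ Q X L).inv, ← cancel_epi (Q ◁ (β_ L X).hom),
      ← cancel_epi (α_ Q L X).hom]
    apply S.detect
    intro K _ _ x hx
    have := h (K ⊗ L) _ ⟨_, _, S.pull (comonFst K L) x hx, T.pull (comonSnd K L) y hy, rfl⟩
    rw [fst_comp_tmul_snd_comp] at this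
    have key (f : Q ⊗ X ⊗ Y ⟶ W) :
        (Q ⊗ L) ◁ x ≫ (α_ Q L X).hom ≫ Q ◁ (β_ L X).hom ≫ (α_ Q X L).inv ≫
          (Q ⊗ X) ◁ y ≫ (α_ Q X Y).hom ≫ f =
        (α_ Q L K).hom ≫ Q ◁ (β_ L K).hom ≫ Q ◁ (x ⊗ₘ y) ≫ f := by
      have e : Q ◁ (β_ L K).hom ≫ Q ◁ (x ⊗ₘ y) = Q ◁ (y ⊗ₘ x) ≫ Q ◁ (β_ Y X).hom := by
        rw [← MonoidalCategory.whiskerLeft_comp, ← MonoidalCategory.whiskerLeft_comp,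
          BraidedCategory.braiding_naturality]
      have e' : (Q ⊗ X) ◁ y ≫ (α_ Q X Y).hom = (α_ Q X L).hom ≫ Q ◁ X ◁ y := by simp
      rw [reassoc_of% e, reassoc_of% e', Iso.inv_hom_id_assoc,
        ← MonoidalCategory.whiskerLeft_comp_assoc _ (β_ L X).hom,
        ← BraidedCategory.braiding_naturality_left, associator_naturality_right_assoc,
        MonoidalCategory.tensorHom_def']
      simp only [MonoidalCategory.whiskerLeft_comp, Category.assoc]
    rw [key, key, this]

attribute [local instance] ComonObj.instTensorUnit CommComon.instCommComonObjUnit in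
/-- The counit is a test element of the unit object. -/
def unit : Tests (𝟙_ C) where
  mem K _ _ t := t = ε[K]
  pull := by
    rintro K L _ _ _ _ r _ _ rfl
    exact IsComonHom.hom_counit r
  detect := by
    intro Q W f g h
    have := h (𝟙_ C) (𝟙 _) rfl
    simpa using this

section All

variable [Preadditive C] [MonoidalPreadditive C] [HasBinaryBiproducts C]

/-- All generalized elements are test elements. -/
def all (X : C) : Tests X where
  mem _ _ _ _ := True
  pull := fun _ _ _ _ => trivial
  detect := by
    intro Q W f g h
    have := congrArg (fun t => Q ◁ Prim.inr X ≫ t) (h (Prim X) (Prim.coord X) trivial)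
    simpa only [← MonoidalCategory.whiskerLeft_comp_assoc, Prim.inr_coord,
      MonoidalCategory.whiskerLeft_id, Category.id_comp] using this

end All

end Tests

section

variable [Preadditive C] [MonoidalPreadditive C] [HasBinaryBiproducts C]

theorem hom_ext_points {X W : C} {f g : X ⟶ W}
    (h : ∀ (K : C) [ComonObj K] [IsCommComonObj K] (t : K ⟶ X), t ≫ f = t ≫ g) : f = g :=
  (Tests.all X).hom_ext fun K _ _ t _ => h K t

theorem hom_ext_points₂ {X Y W : C} {f g : X ⊗ Y ⟶ W}
    (h : ∀ (K : C) [ComonObj K] [IsCommComonObj K] (x : K ⟶ X) (y : K ⟶ Y),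
      x ⊠ y ≫ f = x ⊠ y ≫ g) : f = g := by
  apply ((Tests.all X).tensor (Tests.all Y)).hom_ext
  rintro K _ _ _ ⟨x, y, -, -, rfl⟩
  exact h K x y

theorem hom_ext_points₃ {X Y Z W : C} {f g : X ⊗ (Y ⊗ Z) ⟶ W}
    (h : ∀ (K : C) [ComonObj K] [IsCommComonObj K] (x : K ⟶ X) (y : K ⟶ Y) (z : K ⟶ Z),
      x ⊠ (y ⊠ z) ≫ f = x ⊠ (y ⊠ z) ≫ g) : f = g := by
  apply ((Tests.all X).tensor ((Tests.all Y).tensor (Tests.all Z))).hom_ext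
  rintro K _ _ _ ⟨x, _, -, ⟨y, z, -, -, rfl⟩, rfl⟩
  exact h K x y z

theorem hom_ext_points₄ {X Y Z V W : C} {f g : X ⊗ (Y ⊗ Z) ⊗ V ⟶ W}
    (h : ∀ (K : C) [ComonObj K] [IsCommComonObj K] (x : K ⟶ X) (y : K ⟶ Y) (z : K ⟶ Z)
      (v : K ⟶ V), x ⊠ ((y ⊠ z) ⊠ v) ≫ f = x ⊠ ((y ⊠ z) ⊠ v) ≫ g) : f = g := by
  apply ((Tests.all X).tensor (((Tests.all Y).tensor (Tests.all Z)).tensor (Tests.all V))).hom_ext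
  rintro K _ _ _ ⟨x, _, -, ⟨_, v, ⟨y, z, -, -, rfl⟩, -, rfl⟩, rfl⟩
  exact h K x y z v

end

/-! ### Generalized elements of the free commutative monoid -/

section Free

variable [Preadditive C] [MonoidalPreadditive C] [TensorCocomplete C]

instance hasBinaryBiproducts_of_tensorCocomplete : HasBinaryBiproducts C :=
  HasBinaryBiproducts.of_hasBinaryCoproducts

variable (A : C) {K : C} [ComonObj K] [IsCommComonObj K]

/-- The pure tensors in `A^{⊗ n}` are test elements. -/
noncomputable def Tests.tpow : ∀ n : ℕ, Tests (OddIBL.tpow A n)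
  | 0 => Tests.unit
  | n + 1 => (Tests.tpow n).tensor (Tests.all A)

variable {A}

theorem counit_inc_zero : ε[K] ≫ inc A 0 = 1 := rfl

theorem tmul_mulGen (s : K ⟶ SymObj A) (x : K ⟶ A) : s ⊠ x ≫ mulGen A = s * (x ≫ gen A) := by
  have h : SymObj A ◁ gen A ≫ μ[SymObj A] = mulGen A := by
    change SymObj A ◁ ((λ_ A).inv ≫ inc A 1) ≫ symMul A = _
    rw [MonoidalCategory.whiskerLeft_comp, Category.assoc, inc_symMul]
    change _ ≫ (α_ _ (𝟙_ C) A).inv ≫ (ρ_ (SymObj A)).hom ▷ A ≫ mulGen A = _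
    simp
  rw [← h, tmul_whiskerLeft_assoc, points_mul_def]

theorem tmul_inc_succ (n : ℕ) (m : K ⟶ tpow A n) (x : K ⟶ A) :
    m ⊠ x ≫ inc A (n + 1) = (m ≫ inc A n) * (x ≫ gen A) := by
  rw [← inc_mulGen, tmul_whiskerRight_assoc, tmul_mulGen]

variable (A K) in
/-- The generators of the ring of generalized elements of `S A`. -/
def gens : Set (K ⟶ SymObj A) := Set.range fun x : K ⟶ A => x ≫ gen A

theorem gen_mem_gens (x : K ⟶ A) : x ≫ gen A ∈ gens A K := ⟨x, rfl⟩

theorem IsMonomial.pull {L : C} [ComonObj L] [IsCommComonObj L] (r : L ⟶ K) [IsComonHom r] {n : ℕ}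
    {s : K ⟶ SymObj A} (h : IsMonomial (gens A K) n s) : IsMonomial (gens A L) n (r ≫ s) := by
  induction h with
  | one => rw [comp_one]; exact .one
  | mul _ hx ih =>
    obtain ⟨x, rfl⟩ := hx
    rw [comp_mul, ← Category.assoc]
    exact ih.mul (gen_mem_gens _)

/-- Products of generators are test elements of the free commutative monoid. -/
noncomputable def Tests.sym (A : C) : Tests (SymObj A) where
  mem K _ _ s := ∃ n, IsMonomial (gens A K) n s
  pull := by
    rintro K L _ _ _ _ r _ s ⟨n, h⟩
    exact ⟨n, h.pull r⟩
  detect := by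
    intro Q W f g h
    apply left_hom_ext
    intro n
    apply ((Tests.tpow A n).detect)
    intro K _ _ t ht
    rw [← MonoidalCategory.whiskerLeft_comp_assoc, ← MonoidalCategory.whiskerLeft_comp_assoc]
    apply h K _ ⟨n, ?_⟩
    clear h
    induction n with
    | zero =>
      obtain rfl : t = ε[K] := ht
      exact .one
    | succ n ih =>
      obtain ⟨m, x, hm, -, rfl⟩ := ht
      rw [tmul_inc_succ]
      exact (ih m hm).mul (gen_mem_gens x)

end Free
end Tests
end OddIBL

namespace OddIBL

/-! ### Odd maps as operators on generalized elements. -/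

section OddOperators

set_option linter.unusedSectionVars false

variable {C : Type u} [Category.{v} C] [MonoidalCategory C] [SymmetricCategory C]
  [Preadditive C] [MonoidalPreadditive C] {P : ParityStructure C}

open scoped ComonObj MonObj

section

variable {K : C} [ComonObj K] {x y z : C}

/-- The action of an odd map on generalized elements. -/
def OddHom.act (f : OddHom P x y) (e : K ⟶ P.π) : (K ⟶ x) →+ (K ⟶ y) where
  toFun t := e ⊠ t ≫ f
  map_zero' := by simp
  map_add' s t := by rw [tmul_add, Preadditive.add_comp]

theorem OddHom.act_def (f : OddHom P x y) (e : K ⟶ P.π) (t : K ⟶ x) : f.act e t = e ⊠ t ≫ f := rfl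

theorem OddHom.act_precomp (g : OddHom P y z) (f : x ⟶ y) (e : K ⟶ P.π) (t : K ⟶ x) :
    (g.precomp f).act e t = g.act e (t ≫ f) := by
  simp [OddHom.act_def, OddHom.precomp]

theorem OddHom.act_postcomp (g : y ⟶ z) (f : OddHom P x y) (e : K ⟶ P.π) (t : K ⟶ x) :
    (OddHom.postcomp g f).act e t = f.act e t ≫ g := by
  simp [OddHom.act_def, OddHom.postcomp]

theorem OddHom.act_tensorId (f : OddHom P x y) (e : K ⟶ P.π) (s : K ⟶ x) (t : K ⟶ z) :
    (f.tensorId z).act e (s ⊠ t) = f.act e s ⊠ t := by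
  simp [OddHom.act_def, OddHom.tensorId]

theorem OddHom.act_add (f g : OddHom P x y) (e : K ⟶ P.π) (t : K ⟶ x) :
    OddHom.act (f + g : P.π ⊗ x ⟶ y) e t = f.act e t + g.act e t := by
  simp [OddHom.act_def]

theorem OddHom.act_sub (f g : OddHom P x y) (e : K ⟶ P.π) (t : K ⟶ x) :
    OddHom.act (f - g : P.π ⊗ x ⟶ y) e t = f.act e t - g.act e t := by
  simp [OddHom.act_def]

theorem OddHom.act_zero (e : K ⟶ P.π) (t : K ⟶ x) :
    OddHom.act (0 : P.π ⊗ x ⟶ y) e t = 0 := by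
  simp [OddHom.act_def]

/-- The composite of two odd maps on generalized elements. -/
theorem OddHom.act_act (g : OddHom P y z) (f : OddHom P x y) (e₁ e₂ : K ⟶ P.π) (t : K ⟶ x) :
    g.act e₁ (f.act e₂ t) = (e₁ ⊠ e₂ ≫ P.ξ.hom) ⊠ t ≫ (λ_ x).hom ≫ g.comp f := by
  simp [OddHom.act_def, OddHom.comp]

/-- Exchanging the parameters is the self-braiding of `π`, which is `-1`; this is the only source of
signs. -/
theorem pairing_swap [IsCommComonObj K] (e₁ e₂ : K ⟶ P.π) :
    e₂ ⊠ e₁ ≫ P.ξ.hom = -(e₁ ⊠ e₂ ≫ P.ξ.hom) := by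
  rw [← tmul_braiding e₁ e₂, P.braiding_eq]
  simp

theorem OddHom.act_act_swap [IsCommComonObj K] (g : OddHom P y z) (f : OddHom P x y)
    (e₁ e₂ : K ⟶ P.π) (t : K ⟶ x) : g.act e₂ (f.act e₁ t) = -g.act e₁ (f.act e₂ t) := by
  rw [OddHom.act_act, OddHom.act_act, pairing_swap, neg_tmul, Preadditive.neg_comp]

end

section Ext

variable [HasBinaryBiproducts C] {x y z : C}

/-- A composite of odd maps, preceded by a pairing of odd parameters, vanishes when it vanishes on
test elements. -/
theorem eq_zero_of_pairing (T : Tests x) {f : x ⟶ y} (h : ∀ (K : C) [ComonObj K]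
    [IsCommComonObj K] (e₁ e₂ : K ⟶ P.π) (t : K ⟶ x), T.mem K t →
      (e₁ ⊠ e₂ ≫ P.ξ.hom) ⊠ t ≫ (λ_ x).hom ≫ f = 0) : f = 0 := by
  rw [← cancel_epi (λ_ x).hom, ← cancel_epi (P.ξ.hom ▷ x), comp_zero, comp_zero]
  apply (((Tests.all P.π).tensor (Tests.all P.π)).tensor T).hom_ext
  rintro K _ _ _ ⟨_, t, ⟨e₁, e₂, -, -, rfl⟩, ht, rfl⟩
  rw [tmul_whiskerRight_assoc, h K e₁ e₂ t ht, comp_zero]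

end Ext

section DiffOp

variable {K : C} [ComonObj K] [IsCommComonObj K] {a : C} [MonObj a] [IsCommMonObj a]

/-- The action of an odd endomorphism on the ring of generalized elements. -/
def OddHom.op (f : OddHom P a a) (e : K ⟶ P.π) : AddMonoid.End (K ⟶ a) := f.act e

theorem OddHom.op_apply (f : OddHom P a a) (e : K ⟶ P.π) (t : K ⟶ a) : f.op e t = f.act e t := rfl

/-- The generalized element of `argPow a` given by a list of elements and a last element. -/
def args : ∀ l : List (K ⟶ a), (K ⟶ a) → (K ⟶ argPow a l.length)
  | [], t => t
  | b :: l, t => b ⊠ args l t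

theorem tmul_mulLast (b : K ⟶ a) (l : List (K ⟶ a)) (t : K ⟶ a) :
    b ⊠ args l t ≫ mulLast a l.length = args l (b * t) := by
  induction l with
  | nil => rfl
  | cons c l ih =>
    change b ⊠ (c ⊠ args l t) ≫ (α_ a a (argPow a l.length)).inv ≫
      (β_ a a).hom ▷ argPow a l.length ≫ (α_ a a (argPow a l.length)).hom ≫
        a ◁ mulLast a l.length = c ⊠ args l (b * t)
    simp [ih]

/-- On pure tensors the symmetry that carries `b` past `π` merely reorders the factors, so `oddT` is
the commutator with multiplication by `b`. -/
theorem act_oddTIter (D : OddHom P a a) (e : K ⟶ P.π) (l : List (K ⟶ a)) (t : K ⟶ a) :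
    (oddTIter P a D l.length).act e (args l t) = adMulList l (D.op e) t := by
  induction l generalizing t with
  | nil => rfl
  | cons b l ih =>
    change (oddT P a l.length (oddTIter P a D l.length)).act e (b ⊠ args l t) = _
    rw [adMulList, adMul_apply, ← ih, ← ih, ← tmul_mulLast, oddT, OddHom.act_sub]
    simp [OddHom.act_def, points_mul_def]

theorem isNilOp_of_oddTIter_eq_zero {n : ℕ} {D : OddHom P a a} (h : oddTIter P a D n = 0)
    (e : K ⟶ P.π) : IsNilOp n (D.op e) := by
  rw [isNilOp_iff]
  rintro l rfl
  ext t
  rw [← act_oddTIter, h, OddHom.act_zero, end_zero_apply]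

end DiffOp

section Converse

variable [HasBinaryBiproducts C] {a : C} [MonObj a] [IsCommMonObj a]

/-- The test elements of `argPow a` given by test elements of `a`. -/
def Tests.argPow (T : Tests a) : ∀ n : ℕ, Tests (OddIBL.argPow a n)
  | 0 => Tests.all a
  | n + 1 => T.tensor (Tests.argPow T n)

theorem Tests.exists_args_of_mem_argPow (T : Tests a) {n : ℕ} {K : C} [ComonObj K]
    [IsCommComonObj K] {w : K ⟶ OddIBL.argPow a n} (hw : (T.argPow n).mem K w) :
    ∃ (l : List (K ⟶ a)) (t : K ⟶ a) (h : l.length = n), (∀ b ∈ l, T.mem K b) ∧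
      w = h ▸ args l t := by
  induction n with
  | zero => exact ⟨[], w, rfl, by simp, rfl⟩
  | succ n ih =>
    obtain ⟨b, w, hb, hw, rfl⟩ := hw
    obtain ⟨l, t, rfl, hl, rfl⟩ := ih hw
    exact ⟨b :: l, t, rfl, by simpa using ⟨hb, hl⟩, rfl⟩

/-- A converse to `isNilOp_of_oddTIter_eq_zero` in which the innermost commutator is taken with test
elements only; for `S A` these can be monomials. -/
theorem oddTIter_eq_zero (T : Tests a) {n : ℕ} {D : OddHom P a a}
    (h : ∀ (K : C) [ComonObj K] [IsCommComonObj K] (e : K ⟶ P.π) (b : K ⟶ a), T.mem K b →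
      IsNilOp n (adMul b (D.op e))) : oddTIter P a D (n + 1) = 0 := by
  apply ((Tests.all P.π).tensor (T.argPow (n + 1))).hom_ext
  rintro K _ _ _ ⟨e, w, -, hw, rfl⟩
  obtain ⟨l, t, hn, hl, rfl⟩ := T.exists_args_of_mem_argPow hw
  have key : adMulList l (D.op e) t = 0 := by
    obtain rfl | ⟨l, b, rfl⟩ := l.eq_nil_or_concat'
    · simp at hn
    · rw [adMulList_concat,
        (isNilOp_iff n _).mp (h K e b (hl b (by simp))) l (by simpa using hn), end_zero_apply]
  clear hw
  generalize n + 1 = m at hn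
  subst hn
  exact ((act_oddTIter D e l t).trans key).trans comp_zero.symm

end Converse

end OddOperators
end OddIBL

namespace OddIBL

/-! ### Derivations and short monomials. -/

section Derivation

variable {E : Type*} [CommRing E]

/-- The commutator of a derivation with `b` is multiplication by `F b`, of order `0`. -/
theorem isNilOp_two_of_leibniz {F : AddMonoid.End E} (h : ∀ s t, F (s * t) = F s * t + s * F t) :
    IsNilOp 2 F := by
  intro b c
  change _ = _
  ext t
  simp only [adMul_apply, end_zero_apply, h]
  ring

theorem IsMonomial.length_one {S : Set E} {s : E} (h : IsMonomial S 1 s) : s ∈ S := by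
  cases h with | mul h hx => cases h with | one => rwa [one_mul]

theorem IsMonomial.length_two {S : Set E} {s : E} (h : IsMonomial S 2 s) :
    ∃ x ∈ S, ∃ y ∈ S, s = x * y := by
  cases h with | mul h hx => exact ⟨_, h.length_one, _, hx, rfl⟩

theorem IsMonomial.length_three {S : Set E} {s : E} (h : IsMonomial S 3 s) :
    ∃ x ∈ S, ∃ y ∈ S, ∃ z ∈ S, s = x * y * z := by
  cases h with
  | mul h hx =>
    obtain ⟨x, hx', y, hy, rfl⟩ := h.length_two
    exact ⟨x, hx', y, hy, _, hx, rfl⟩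

theorem IsMonomial.length_zero {S : Set E} {s : E} (h : IsMonomial S 0 s) : s = 1 := by
  cases h; rfl

end Derivation

/-! ### Recursive construction of maps out of `Q ⊗ S A`. -/

section Extension

set_option linter.unusedSectionVars false

variable {C : Type u} [Category.{v} C] [MonoidalCategory C] [SymmetricCategory C]
  [Preadditive C] [MonoidalPreadditive C] [TensorCocomplete C] {A Q W : C}

open scoped ComonObj MonObj

theorem IsMonomial.exists_inc {K : C} [ComonObj K] [IsCommComonObj K] {n : ℕ} {s : K ⟶ SymObj A}
    (h : IsMonomial (gens A K) n s) : ∃ m, s = m ≫ inc A n := by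
  induction h with
  | one => exact ⟨ε[K], rfl⟩
  | mul _ hx ih =>
    obtain ⟨x, rfl⟩ := hx
    obtain ⟨m, rfl⟩ := ih
    exact ⟨m ⊠ x, (tmul_inc_succ _ m x).symm⟩

section Construction

variable (act : W ⊗ A ⟶ W) (c : Q ⟶ W) (ψ : Q ⊗ (SymObj A ⊗ A) ⟶ W)

/-- The components on `A^{⊗ n}` of the map constructed in `exists_extension`. -/
noncomputable def extensionAux : ∀ n : ℕ, Q ⊗ tpow A n ⟶ W
  | 0 => (ρ_ Q).hom ≫ c
  | n + 1 => (α_ Q (tpow A n) A).inv ≫ extensionAux n ▷ A ≫ act + Q ◁ (inc A n ▷ A) ≫ ψ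

theorem tmul_extensionAux_succ {K : C} [ComonObj K] (q : K ⟶ Q) (n : ℕ) (m : K ⟶ tpow A n)
    (x : K ⟶ A) : q ⊠ (m ⊠ x) ≫ extensionAux act c ψ (n + 1) =
      (q ⊠ m ≫ extensionAux act c ψ n) ⊠ x ≫ act + q ⊠ ((m ≫ inc A n) ⊠ x) ≫ ψ := by
  simp [extensionAux]

variable (hact : (α_ W A A).hom ≫ W ◁ (β_ A A).hom ≫ (α_ W A A).inv ≫ act ▷ A ≫ act =
    act ▷ A ≫ act)
  (hψ : ∀ (K : C) [ComonObj K] [IsCommComonObj K] (q : K ⟶ Q) (s : K ⟶ SymObj A) (x y : K ⟶ A),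
    (q ⊠ (s ⊠ x) ≫ ψ) ⊠ y ≫ act + q ⊠ ((s * (x ≫ gen A)) ⊠ y) ≫ ψ =
    (q ⊠ (s ⊠ y) ≫ ψ) ⊠ x ≫ act + q ⊠ ((s * (y ≫ gen A)) ⊠ x) ≫ ψ)

include hact hψ in
-- The essential case is the last transposition. Unrolling the recursion twice gives one term that
-- is symmetric in the last two factors by `hact`, and two terms whose sum is symmetric by `hψ`.
theorem perm_extensionAux (n : ℕ) (f : tpow A n ⟶ tpow A n) (hf : IsPerm A n f) :
    Q ◁ f ≫ extensionAux act c ψ n = extensionAux act c ψ n := by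
  induction hf with
  | id n => simp
  | comp n f g _ _ hf hg => rw [MonoidalCategory.whiskerLeft_comp, Category.assoc, hg, hf]
  | swapLast n =>
    apply ((Tests.all Q).tensor
      (((Tests.all (tpow A n)).tensor (Tests.all A)).tensor (Tests.all A))).hom_ext
    rintro K _ _ _ ⟨q, _, -, ⟨_, y, ⟨m, x, -, -, rfl⟩, -, rfl⟩, rfl⟩
    have h1 := congrArg (fun t => ((q ⊠ m ≫ extensionAux act c ψ n) ⊠ x) ⊠ y ≫ t) hact
    simp only [tmul_associator_hom_assoc, tmul_whiskerLeft_assoc, tmul_braiding,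
      tmul_associator_inv_assoc, tmul_whiskerRight_assoc] at h1
    have key (x y : K ⟶ A) : q ⊠ ((m ⊠ x) ⊠ y) ≫ extensionAux act c ψ (n + 2) =
        ((q ⊠ m ≫ extensionAux act c ψ n) ⊠ x ≫ act) ⊠ y ≫ act +
          ((q ⊠ ((m ≫ inc A n) ⊠ x) ≫ ψ) ⊠ y ≫ act +
            q ⊠ (((m ≫ inc A n) * (x ≫ gen A)) ⊠ y) ≫ ψ) := by
      refine (tmul_extensionAux_succ act c ψ q (n + 1) (m ⊠ x) y).trans ?_
      rw [tmul_extensionAux_succ, tmul_inc_succ, add_tmul, Preadditive.add_comp, add_assoc]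
    have e : q ⊠ ((m ⊠ x) ⊠ y) ≫ Q ◁ ((α_ (tpow A n) A A).hom ≫ tpow A n ◁ (β_ A A).hom ≫
        (α_ (tpow A n) A A).inv) = q ⊠ ((m ⊠ y) ⊠ x) := by simp
    rw [← Category.assoc]
    refine (congrArg (fun t => t ≫ extensionAux act c ψ (n + 2)) e).trans ?_
    refine (key y x).trans (Eq.trans ?_ (key x y).symm)
    rw [h1, hψ]
  | whisker n f hf ih =>
    apply hom_ext_points₃
    intro K _ _ q m x
    have := congrArg (fun t => q ⊠ m ≫ t) ih
    simp only [tmul_whiskerLeft_assoc] at this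
    rw [tmul_whiskerLeft_assoc, tmul_whiskerRight, tmul_extensionAux_succ, tmul_extensionAux_succ,
      this, Category.assoc, perm_inc A n f hf]

include hact hψ in
/-- Maps out of `Q ⊗ S A` can be constructed by recursion on the length of monomials. -/
theorem exists_extension : ∃ D : Q ⊗ SymObj A ⟶ W,
    (∀ (K : C) [ComonObj K] [IsCommComonObj K] (q : K ⟶ Q), q ⊠ (1 : K ⟶ SymObj A) ≫ D = q ≫ c) ∧
    ∀ (K : C) [ComonObj K] [IsCommComonObj K] (q : K ⟶ Q) (s : K ⟶ SymObj A) (x : K ⟶ A),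
      q ⊠ (s * (x ≫ gen A)) ≫ D = (q ⊠ s ≫ D) ⊠ x ≫ act + q ⊠ (s ⊠ x) ≫ ψ := by
  let D := descLeft A Q (extensionAux act c ψ) (perm_extensionAux act c ψ hact hψ)
  have hD : ∀ (K : C) [ComonObj K] (q : K ⟶ Q) (n : ℕ) (m : K ⟶ tpow A n),
      q ⊠ (m ≫ inc A n) ≫ D = q ⊠ m ≫ extensionAux act c ψ n := by
    intro K _ q n m
    rw [← tmul_whiskerLeft_assoc, descLeft_fac]
  -- The recursion is known for elements that factor through some `inc A n`. Monomials do, and they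
  -- suffice to prove it as an equality of maps, hence for all elements.
  have h : Q ◁ mulGen A ≫ D = (α_ Q (SymObj A) A).inv ≫ D ▷ A ≫ act + ψ := by
    apply ((Tests.all Q).tensor ((Tests.sym A).tensor (Tests.all A))).hom_ext
    rintro K _ _ _ ⟨q, _, -, ⟨s, x, ⟨n, hs⟩, -, rfl⟩, rfl⟩
    obtain ⟨m, rfl⟩ := hs.exists_inc
    have h3 := (hD K q (n + 1) (m ⊠ x)).trans (tmul_extensionAux_succ act c ψ q n m x)
    rw [tmul_inc_succ, ← hD] at h3
    rw [tmul_whiskerLeft_assoc, tmul_mulGen, h3, Preadditive.comp_add, tmul_associator_inv_assoc, tmul_whiskerRight_assoc]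
  refine ⟨D, fun K _ _ q => ?_, fun K _ _ q s x => ?_⟩
  · exact (hD K q 0 ε[K]).trans (tmul_counit_rightUnitor_assoc q c)
  · have := congrArg (fun t => q ⊠ (s ⊠ x) ≫ t) h
    simpa only [tmul_whiskerLeft_assoc, tmul_mulGen, Preadditive.comp_add,
      tmul_associator_inv_assoc, tmul_whiskerRight_assoc] using this

end Construction

/-- A map `Q ⊗ A ⟶ S A` extends to a derivation of `S A` with parameters in `Q`. -/
theorem exists_derivation (φ : Q ⊗ A ⟶ SymObj A) : ∃ D : Q ⊗ SymObj A ⟶ SymObj A,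
    (∀ (K : C) [ComonObj K] [IsCommComonObj K] (q : K ⟶ Q) (s t : K ⟶ SymObj A),
      q ⊠ (s * t) ≫ D = (q ⊠ s ≫ D) * t + s * (q ⊠ t ≫ D)) ∧
    ∀ (K : C) [ComonObj K] [IsCommComonObj K] (q : K ⟶ Q) (x : K ⟶ A),
      q ⊠ (x ≫ gen A) ≫ D = q ⊠ x ≫ φ := by
  -- In elements `ψ (q, s, x) = φ (q, x) s`, so the recursion reads `D (s x) = D (s) x + φ (x) s`.
  let ψ : Q ⊗ (SymObj A ⊗ A) ⟶ SymObj A :=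
    Q ◁ (β_ (SymObj A) A).hom ≫ (α_ Q A (SymObj A)).inv ≫ φ ▷ SymObj A ≫ μ[SymObj A]
  have hψ : ∀ (K : C) [ComonObj K] [IsCommComonObj K] (q : K ⟶ Q) (s : K ⟶ SymObj A) (x : K ⟶ A),
      q ⊠ (s ⊠ x) ≫ ψ = (q ⊠ x ≫ φ) * s := by
    intro K _ _ q s x
    simp [ψ, points_mul_def]
  obtain ⟨D, h1, h2⟩ := exists_extension (mulGen A) (0 : Q ⟶ SymObj A) ψ (mulGen_swap A) (by
    intro K _ _ q s x y
    simp only [hψ, tmul_mulGen]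
    ring)
  simp only [comp_zero, hψ, tmul_mulGen] at h1 h2
  -- The Leibniz rule as an equality of maps, so that its second argument may be taken to be a
  -- monomial and treated by induction.
  have hL : Q ◁ μ[SymObj A] ≫ D = (α_ Q (SymObj A) (SymObj A)).inv ≫ D ▷ SymObj A ≫ μ[SymObj A] +
      Q ◁ (β_ (SymObj A) (SymObj A)).hom ≫ (α_ Q (SymObj A) (SymObj A)).inv ≫ D ▷ SymObj A ≫
        μ[SymObj A] := by
    apply ((Tests.all Q).tensor ((Tests.all (SymObj A)).tensor (Tests.sym A))).hom_ext
    rintro K _ _ _ ⟨q, _, -, ⟨s, t, -, ⟨n, ht⟩, rfl⟩, rfl⟩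
    simp only [tmul_whiskerLeft_assoc, Preadditive.comp_add, tmul_associator_inv_assoc,
      tmul_whiskerRight_assoc, tmul_braiding, points_mul_def]
    induction ht with
    | one => simp [h1]
    | mul _ hx ih =>
      obtain ⟨x, rfl⟩ := hx
      rw [← mul_assoc, h2, ih, h2]
      ring
  refine ⟨D, fun K _ _ q s t => ?_, fun K _ _ q x => ?_⟩
  · have := congrArg (fun r => q ⊠ (s ⊠ t) ≫ r) hL
    simp only [tmul_whiskerLeft_assoc, Preadditive.comp_add, tmul_associator_inv_assoc,
      tmul_whiskerRight_assoc, tmul_braiding, points_mul_def] at this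
    rw [this, mul_comm s]
  · have := h2 K q 1 x
    rwa [one_mul, h1, zero_mul, zero_add, mul_one] at this

end Extension

end OddIBL

namespace OddIBL

/-! ### Existence and uniqueness of the extensions of `br` and `δ`. -/

section Extensions

set_option linter.unusedSectionVars false

variable {C : Type u} [Category.{v} C] [MonoidalCategory C] [SymmetricCategory C]
  [Preadditive C] [MonoidalPreadditive C] [TensorCocomplete C] {P : ParityStructure C} {A : C}

open scoped ComonObj MonObj

theorem tmul_genMul {K : C} [ComonObj K] [IsCommComonObj K] (x y : K ⟶ A) :
    x ⊠ y ≫ genMul A = (x ≫ gen A) * (y ≫ gen A) := by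
  rw [genMul, tmul_tensorHom_assoc, points_mul_def]

theorem braiding_genMul : (β_ A A).hom ≫ genMul A = genMul A := by
  apply hom_ext_points₂
  intro K _ _ x y
  rw [tmul_braiding_assoc, tmul_genMul, tmul_genMul, mul_comm]

theorem precomp_one_eq_zero_iff {D : OddHom P (SymObj A) (SymObj A)} :
    D.precomp η[SymObj A] = 0 ↔
      ∀ (K : C) [ComonObj K] [IsCommComonObj K] (e : K ⟶ P.π), D.act e 1 = 0 := by
  constructor
  · intro h K _ _ e
    rw [← points_one_def, ← OddHom.act_precomp, h, OddHom.act_zero]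
  · intro h
    apply ((Tests.all P.π).tensor Tests.unit).hom_ext
    rintro K _ _ _ ⟨e, _, -, rfl, rfl⟩
    rw [comp_zero]
    change (D.precomp η[SymObj A]).act e ε[K] = 0
    rw [OddHom.act_precomp, points_one_def, h]

section Bracket

variable {br : OddHom P (A ⊗ A) A} {D : OddHom P (SymObj A) (SymObj A)}

namespace IsBracketExtension

variable {K : C} [ComonObj K] [IsCommComonObj K] (e : K ⟶ P.π)

theorem isNilOp (h : IsBracketExtension br D) : IsNilOp 3 (D.op e) :=
  isNilOp_of_oddTIter_eq_zero h.diffOp e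

theorem act_one (h : IsBracketExtension br D) : D.act e 1 = 0 :=
  precomp_one_eq_zero_iff.mp h.unit K e

theorem act_gen (h : IsBracketExtension br D) (x : K ⟶ A) : D.act e (x ≫ OddIBL.gen A) = 0 := by
  rw [← OddHom.act_precomp, h.gen, OddHom.act_zero]

theorem act_genMul (h : IsBracketExtension br D) (w : K ⟶ A ⊗ A) :
    D.act e (w ≫ OddIBL.genMul A) = br.act e w ≫ OddIBL.gen A := by
  rw [← OddHom.act_precomp, h.genMul, OddHom.act_postcomp]

theorem act_gen_mul_gen (h : IsBracketExtension br D) (x y : K ⟶ A) :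
    D.act e ((x ≫ OddIBL.gen A) * (y ≫ OddIBL.gen A)) = br.act e (x ⊠ y) ≫ OddIBL.gen A := by
  rw [← tmul_genMul, h.act_genMul]

/-- The triple commutator with the three generators vanishes at `1`; expanding it expresses the
value on `x y z` through shorter monomials. -/
theorem act_gen_mul_gen_mul_gen (h : IsBracketExtension br D) (x y z : K ⟶ A) :
    D.act e ((x ≫ OddIBL.gen A) * (y ≫ OddIBL.gen A) * (z ≫ OddIBL.gen A)) =
      (br.act e (x ⊠ y) ≫ OddIBL.gen A) * (z ≫ OddIBL.gen A) +
      (br.act e (x ⊠ z) ≫ OddIBL.gen A) * (y ≫ OddIBL.gen A) +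
      (br.act e (y ⊠ z) ≫ OddIBL.gen A) * (x ≫ OddIBL.gen A) := by
  have h3 := DFunLike.congr_fun
    (h.isNilOp e (x ≫ OddIBL.gen A) (y ≫ OddIBL.gen A) (z ≫ OddIBL.gen A)) 1
  simp only [adMul_apply, mul_one, OddHom.op_apply, h.act_one, h.act_gen, h.act_gen_mul_gen,
    end_zero_apply] at h3
  rw [← mul_assoc] at h3
  linear_combination h3

end IsBracketExtension

theorem IsBracketExtension.unique {D' : OddHom P (SymObj A) (SymObj A)}
    (h : IsBracketExtension br D) (h' : IsBracketExtension br D') : D = D' := by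
  apply ((Tests.all P.π).tensor (Tests.sym A)).hom_ext
  rintro K _ _ _ ⟨e, s, -, ⟨n, hs⟩, rfl⟩
  rw [← sub_eq_zero]
  have h3 : IsNilOp 3 (D.op e + -D'.op e) := (h.isNilOp e).add (h'.isNilOp e).neg
  have := h3.eq_zero_of_monomial (S := gens A K) (k := 2) (fun m hm t ht => by
    simp only [end_add_apply, end_neg_apply, OddHom.op_apply]
    match m, hm with
    | 0, _ => rw [ht.length_zero, h.act_one, h'.act_one, neg_zero, add_zero]
    | 1, _ =>
      obtain ⟨x, rfl⟩ := ht.length_one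
      rw [h.act_gen, h'.act_gen, neg_zero, add_zero]
    | 2, _ =>
      obtain ⟨_, ⟨x, rfl⟩, _, ⟨y, rfl⟩, rfl⟩ := ht.length_two
      rw [h.act_gen_mul_gen, h'.act_gen_mul_gen, add_neg_cancel]) hs
  rw [end_add_apply, end_neg_apply, ← sub_eq_add_neg] at this
  exact this

/-- The commutator of the operator with a generator `x` has to be the derivation `B_x` extending `br
(x, -)`. Such derivations exist with parameters in `π ⊗ A`, and the operator is then defined by `D
(s x) = D (s) x + B_x (s)`. Independence of the order of the generators amounts to `B_x (y) = B_y
(x)`, the symmetry of `br`. -/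
theorem exists_isBracketExtension (hbr : IsSymmBracket br) :
    ∃ D : OddHom P (SymObj A) (SymObj A), IsBracketExtension br D := by
  obtain ⟨B, hB, hBx⟩ := exists_derivation ((α_ P.π A A).hom ≫ br ≫ gen A)
  let ψ : P.π ⊗ (SymObj A ⊗ A) ⟶ SymObj A :=
    P.π ◁ (β_ (SymObj A) A).hom ≫ (α_ P.π A (SymObj A)).inv ≫ B
  have hψ : ∀ (K : C) [ComonObj K] [IsCommComonObj K] (e : K ⟶ P.π) (s : K ⟶ SymObj A)
      (x : K ⟶ A), e ⊠ (s ⊠ x) ≫ ψ = (e ⊠ x) ⊠ s ≫ B := by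
    intro K _ _ e s x
    simp [ψ]
  have hsymm : ∀ (K : C) [ComonObj K] [IsCommComonObj K] (e : K ⟶ P.π) (x y : K ⟶ A),
      e ⊠ (x ⊠ y) ≫ br ≫ gen A = e ⊠ (y ⊠ x) ≫ br ≫ gen A := by
    intro K _ _ e x y
    conv_lhs => rw [← hbr, OddHom.precomp, Category.assoc, tmul_whiskerLeft_assoc, tmul_braiding]
  have hBxy : ∀ (K : C) [ComonObj K] [IsCommComonObj K] (e : K ⟶ P.π) (x y : K ⟶ A),
      (e ⊠ x) ⊠ (y ≫ gen A) ≫ B = e ⊠ (x ⊠ y) ≫ br ≫ gen A := by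
    intro K _ _ e x y
    rw [hBx, tmul_associator_hom_assoc]
  have hB1 : ∀ (K : C) [ComonObj K] [IsCommComonObj K] (e : K ⟶ P.π) (x : K ⟶ A),
      (e ⊠ x) ⊠ (1 : K ⟶ SymObj A) ≫ B = 0 := by
    intro K _ _ e x
    simpa using hB K (e ⊠ x) 1 1
  obtain ⟨D, h1, h2⟩ := exists_extension (mulGen A) (0 : P.π ⟶ SymObj A) ψ (mulGen_swap A) (by
    intro K _ _ e s x y
    simp only [hψ, tmul_mulGen, hB, hBxy]
    rw [hsymm K e x y]
    ring)
  simp only [comp_zero, hψ, tmul_mulGen] at h1 h2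
  have hgen : ∀ (K : C) [ComonObj K] [IsCommComonObj K] (e : K ⟶ P.π) (x : K ⟶ A),
      e ⊠ (x ≫ gen A) ≫ D = 0 := by
    intro K _ _ e x
    simpa [h1, hB1] using h2 K e 1 x
  refine ⟨D, ?_, precomp_one_eq_zero_iff.mpr h1, ?_, ?_⟩
  · refine oddTIter_eq_zero (n := 2) (Tests.sym A) ?_
    rintro K _ _ e s ⟨n, hs⟩
    -- Commutators with generators are derivations, of order `1`; this passes to commutators with
    -- monomials.
    refine IsNilOp.adMul_monomial ?_ hs
    rintro _ ⟨x, rfl⟩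
    have hx : ∀ t, adMul (x ≫ gen A) (OddHom.op D e) t = (e ⊠ x) ⊠ t ≫ B := by
      intro t
      rw [adMul_apply, OddHom.op_apply, OddHom.op_apply, OddHom.act_def, OddHom.act_def, mul_comm,
        h2]
      ring
    apply isNilOp_two_of_leibniz
    intro s t
    rw [hx, hx, hx, hB]
  · apply hom_ext_points₂
    intro K _ _ e x
    rw [OddHom.precomp, tmul_whiskerLeft_assoc, hgen, comp_zero]
  · apply hom_ext_points₃
    intro K _ _ e x y
    rw [OddHom.precomp, tmul_whiskerLeft_assoc, tmul_genMul, h2, hgen, hBxy, hsymm, zero_mul,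
      zero_add, OddHom.postcomp]

end Bracket

section Cobracket

variable {δ : OddHom P A (A ⊗ A)} {D : OddHom P (SymObj A) (SymObj A)}

namespace IsCobracketExtension

variable {K : C} [ComonObj K] [IsCommComonObj K] (e : K ⟶ P.π)

theorem isNilOp (h : IsCobracketExtension δ D) : IsNilOp 2 (D.op e) :=
  isNilOp_of_oddTIter_eq_zero h.diffOp e

theorem act_one (h : IsCobracketExtension δ D) : D.act e 1 = 0 :=
  precomp_one_eq_zero_iff.mp h.unit K e

theorem act_gen (h : IsCobracketExtension δ D) (x : K ⟶ A) :
    D.act e (x ≫ OddIBL.gen A) = δ.act e x ≫ genMul A := by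
  rw [← OddHom.act_precomp, h.gen, OddHom.act_postcomp]

/-- An operator of order `1` that kills the unit is a derivation. -/
theorem act_mul (h : IsCobracketExtension δ D) (s t : K ⟶ SymObj A) :
    D.act e (s * t) = D.act e s * t + s * D.act e t := by
  have h2 := DFunLike.congr_fun (h.isNilOp e s t) 1
  simp only [adMul_apply, mul_one, OddHom.op_apply, h.act_one, end_zero_apply] at h2
  linear_combination h2

end IsCobracketExtension

theorem IsCobracketExtension.unique {D' : OddHom P (SymObj A) (SymObj A)}
    (h : IsCobracketExtension δ D) (h' : IsCobracketExtension δ D') : D = D' := by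
  apply ((Tests.all P.π).tensor (Tests.sym A)).hom_ext
  rintro K _ _ _ ⟨e, s, -, ⟨n, hs⟩, rfl⟩
  change D.act e s = D'.act e s
  induction hs with
  | one => rw [h.act_one, h'.act_one]
  | mul _ hx ih =>
    obtain ⟨x, rfl⟩ := hx
    rw [h.act_mul, h'.act_mul, ih, h.act_gen, h'.act_gen]

variable (δ) in
theorem exists_isCobracketExtension :
    ∃ D : OddHom P (SymObj A) (SymObj A), IsCobracketExtension δ D := by
  obtain ⟨D, hD, hDx⟩ := exists_derivation ((δ : P.π ⊗ A ⟶ A ⊗ A) ≫ genMul A)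
  refine ⟨D, ?_, precomp_one_eq_zero_iff.mpr fun K _ _ e => ?_, ?_⟩
  · refine oddTIter_eq_zero (n := 1) (Tests.all _) ?_
    intro K _ _ e s _
    exact isNilOp_two_of_leibniz (F := OddHom.op D e) (hD K e) s
  · simpa [OddHom.act_def] using hD K e 1 1
  · apply hom_ext_points₂
    intro K _ _ e x
    rw [OddHom.precomp, tmul_whiskerLeft_assoc, hDx, OddHom.postcomp]

end Cobracket

/-! ### Projections of the free commutative monoid to tensor powers -/

section Projections

variable (A)

/-- The product of three generators. -/
noncomputable def genMul₃ : (A ⊗ A) ⊗ A ⟶ SymObj A := genMul A ▷ A ≫ mulGen A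

variable {A} in
theorem tmul_genMul₃ {K : C} [ComonObj K] [IsCommComonObj K] (w : K ⟶ A ⊗ A) (z : K ⟶ A) :
    w ⊠ z ≫ genMul₃ A = (w ≫ genMul A) * (z ≫ gen A) := by
  rw [genMul₃, tmul_whiskerRight_assoc, tmul_mulGen]

/-- The augmentation of `S A`. -/
theorem exists_augmentation : ∃ p : SymObj A ⟶ 𝟙_ C,
    (∀ (K : C) [ComonObj K] [IsCommComonObj K], (1 : K ⟶ SymObj A) ≫ p = ε[K]) ∧
    ∀ (K : C) [ComonObj K] [IsCommComonObj K] (s : K ⟶ SymObj A) (x : K ⟶ A),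
      (s * (x ≫ gen A)) ≫ p = 0 := by
  obtain ⟨D, h1, h2⟩ := exists_extension (A := A) (Q := 𝟙_ C) (W := 𝟙_ C) 0 (𝟙 _) 0 (by simp)
    (by simp)
  have h : ∀ (K : C) [ComonObj K] [IsCommComonObj K] (s : K ⟶ SymObj A),
      s ≫ (λ_ _).inv ≫ D = ε[K] ⊠ s ≫ D := by
    intro K _ _ s
    rw [tmul_eq_leftUnitor_inv, Category.assoc]
  refine ⟨(λ_ _).inv ≫ D, fun K _ _ => ?_, fun K _ _ s x => ?_⟩
  · rw [h, h1, Category.comp_id]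
  · rw [h, h2, comp_zero, comp_zero, add_zero]

/-- The de Rham differential of `S A`. -/
theorem exists_deRham : ∃ d : SymObj A ⟶ SymObj A ⊗ A,
    ∀ (K : C) [ComonObj K] [IsCommComonObj K] (x y z : K ⟶ A),
      x ≫ gen A ≫ d = 1 ⊠ x ∧
      ((x ≫ gen A) * (y ≫ gen A)) ≫ d = (x ≫ gen A) ⊠ y + (y ≫ gen A) ⊠ x ∧
      ((x ≫ gen A) * (y ≫ gen A) * (z ≫ gen A)) ≫ d =
        ((x ≫ gen A) * (y ≫ gen A)) ⊠ z + ((x ≫ gen A) * (z ≫ gen A)) ⊠ y +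
          ((y ≫ gen A) * (z ≫ gen A)) ⊠ x := by
  let act : (SymObj A ⊗ A) ⊗ A ⟶ SymObj A ⊗ A :=
    (α_ _ _ _).hom ≫ SymObj A ◁ (β_ A A).hom ≫ (α_ _ _ _).inv ≫ mulGen A ▷ A
  have hact : ∀ (K : C) [ComonObj K] [IsCommComonObj K] (s : K ⟶ SymObj A) (y x : K ⟶ A),
      (s ⊠ y) ⊠ x ≫ act = (s * (x ≫ gen A)) ⊠ y := by
    intro K _ _ s y x
    simp [act, tmul_mulGen]
  -- The recursion is `d (s x) = d (s) x + s ⊗ x`, with `act` multiplying into the first factor and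
  -- `ψ` the identity up to the unitor.
  obtain ⟨D, h1, h2⟩ := exists_extension (A := A) (Q := 𝟙_ C) (W := SymObj A ⊗ A) act 0
    (λ_ _).hom (by
      apply (((((Tests.all (SymObj A)).tensor (Tests.all A))).tensor (Tests.all A)).tensor
        (Tests.all A)).hom_ext
      rintro K _ _ _ ⟨_, y, ⟨_, x, ⟨s, z, -, -, rfl⟩, -, rfl⟩, -, rfl⟩
      simp only [tmul_associator_hom_assoc, tmul_whiskerLeft_assoc, tmul_braiding,
        tmul_associator_inv_assoc, tmul_whiskerRight_assoc, hact]
      rw [mul_right_comm]) (by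
      intro K _ _ q s x y
      have hq (t : K ⟶ SymObj A) (x : K ⟶ A) : q ⊠ (t ⊠ x) ≫ (λ_ (SymObj A ⊗ A)).hom =
          (q ⊠ t ≫ (λ_ (SymObj A)).hom) ⊠ x := by
        rw [← tmul_whiskerRight, ← tmul_associator_inv_assoc]
        simp
      have hmul (t u : K ⟶ SymObj A) : q ⊠ (t * u) ≫ (λ_ (SymObj A)).hom =
          (q ⊠ t ≫ (λ_ (SymObj A)).hom) * u := by
        rw [← points_mul_def, ← points_mul_def, ← tmul_whiskerLeft_assoc, leftUnitor_naturality,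
          ← tmul_associator_hom_assoc, ← tmul_whiskerRight, Category.assoc,
          MonoidalCategory.leftUnitor_tensor_hom_assoc, tmul_associator_hom_assoc,
          tmul_associator_inv_assoc]
      rw [hq, hq, hq, hq, hact, hact, hmul, hmul, add_comm])
  have h : ∀ (K : C) [ComonObj K] [IsCommComonObj K] (s : K ⟶ SymObj A),
      s ≫ (λ_ _).inv ≫ D = ε[K] ⊠ s ≫ D := by
    intro K _ _ s
    rw [tmul_eq_leftUnitor_inv, Category.assoc]
  simp only [comp_zero] at h1
  have hd1 : ∀ (K : C) [ComonObj K] [IsCommComonObj K] (x : K ⟶ A),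
      x ≫ gen A ≫ (λ_ _).inv ≫ D = 1 ⊠ x := by
    intro K _ _ x
    have := h2 K ε[K] 1 x
    rw [h1, one_mul, zero_tmul, zero_comp, zero_add, counit_tmul_leftUnitor] at this
    rw [← this, ← h, Category.assoc]
  have hd2 : ∀ (K : C) [ComonObj K] [IsCommComonObj K] (x y : K ⟶ A),
      ((x ≫ gen A) * (y ≫ gen A)) ≫ (λ_ _).inv ≫ D = (x ≫ gen A) ⊠ y + (y ≫ gen A) ⊠ x := by
    intro K _ _ x y
    rw [h, h2, ← h, Category.assoc, hd1, hact, one_mul, counit_tmul_leftUnitor, add_comm]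
  refine ⟨(λ_ _).inv ≫ D, fun K _ _ x y z => ⟨hd1 K x, hd2 K x y, ?_⟩⟩
  rw [h, h2, ← h, hd2, add_tmul, Preadditive.add_comp, hact, hact, counit_tmul_leftUnitor]
  abel

/-- The projection of `S A` to `A`. -/
theorem exists_proj₁ : ∃ p : SymObj A ⟶ A,
    gen A ≫ p = 𝟙 A ∧ genMul₃ A ≫ p = 0 := by
  obtain ⟨d, hd⟩ := exists_deRham A
  obtain ⟨a, ha1, ha2⟩ := exists_augmentation A
  -- After `d`, the augmentation retains only the terms whose first factor has degree `0`.
  refine ⟨d ≫ a ▷ A ≫ (λ_ A).hom, hom_ext_points fun K _ _ x => ?_, ?_⟩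
  · have := (hd K x x x).1
    rw [reassoc_of% this, tmul_whiskerRight_assoc, ha1, counit_tmul_leftUnitor, Category.comp_id]
  · apply (((Tests.all A).tensor (Tests.all A)).tensor (Tests.all A)).hom_ext
    rintro K _ _ _ ⟨_, z, ⟨x, y, -, -, rfl⟩, -, rfl⟩
    have := (hd K x y z).2.2
    rw [← Category.assoc, tmul_genMul₃, tmul_genMul, reassoc_of% this]
    simp [Preadditive.add_comp, ha2]

/-- The projection of `S A` to `A ⊗ A`. -/
theorem exists_proj₂ : ∃ p : SymObj A ⟶ A ⊗ A, genMul A ≫ p = symm₂ A := by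
  obtain ⟨d, hd⟩ := exists_deRham A
  obtain ⟨p, hp, -⟩ := exists_proj₁ A
  refine ⟨d ≫ p ▷ A, hom_ext_points₂ fun K _ _ x y => ?_⟩
  have := (hd K x y y).2.1
  rw [← Category.assoc, tmul_genMul, reassoc_of% this, Preadditive.add_comp,
    tmul_whiskerRight, tmul_whiskerRight, Category.assoc, Category.assoc, hp, symm₂,
    Preadditive.comp_add, tmul_braiding]
  simp

theorem tmul_symm₃ {K : C} [ComonObj K] [IsCommComonObj K] (x y z : K ⟶ A) :
    (x ⊠ y) ⊠ z ≫ symm₃ A = (x ⊠ y) ⊠ z + (y ⊠ z) ⊠ x + (z ⊠ x) ⊠ y := by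
  simp [symm₃, cyc₃, Preadditive.comp_add]

/-- The projection of `S A` to `A ⊗ A ⊗ A`. -/
theorem exists_proj₃ : ∃ p : SymObj A ⟶ (A ⊗ A) ⊗ A,
    genMul₃ A ≫ p = (𝟙 _ + (β_ A A).hom ▷ A) ≫ symm₃ A := by
  obtain ⟨d, hd⟩ := exists_deRham A
  obtain ⟨p, hp⟩ := exists_proj₂ A
  -- Here `d` chooses the last of the three factors and `p` symmetrizes the other two; the six terms
  -- are the cyclic symmetrization of the two orders of the first pair.
  refine ⟨d ≫ p ▷ A, ?_⟩
  apply (((Tests.all A).tensor (Tests.all A)).tensor (Tests.all A)).hom_ext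
  rintro K _ _ _ ⟨_, z, ⟨x, y, -, -, rfl⟩, -, rfl⟩
  have := (hd K x y z).2.2
  rw [← Category.assoc, tmul_genMul₃, tmul_genMul, reassoc_of% this]
  simp only [← tmul_genMul, Preadditive.add_comp, Preadditive.comp_add, tmul_whiskerRight,
    Category.assoc, hp, symm₂, Category.comp_id, tmul_braiding, add_tmul, tmul_symm₃,
    tmul_whiskerRight_assoc, Category.id_comp]
  abel

end Projections

end Extensions

end OddIBL

namespace OddIBL

/-! ### The square of the sum of the extensions. -/

section Square

set_option linter.unusedSectionVars false

variable {C : Type u} [Category.{v} C] [MonoidalCategory C] [SymmetricCategory C]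
  [Preadditive C] [MonoidalPreadditive C] {P : ParityStructure C}

open scoped ComonObj MonObj

section Pairing

variable {K x y z : C} [ComonObj K]

/-- Multiplication of a generalized element by the pairing of two odd parameters. -/
def pairSMul (e₁ e₂ : K ⟶ P.π) (t : K ⟶ x) : K ⟶ x := (e₁ ⊠ e₂ ≫ P.ξ.hom) ⊠ t ≫ (λ_ x).hom

theorem pairSMul_comp (e₁ e₂ : K ⟶ P.π) (t : K ⟶ x) (f : x ⟶ y) :
    pairSMul e₁ e₂ t ≫ f = pairSMul e₁ e₂ (t ≫ f) := by
  rw [pairSMul, pairSMul, Category.assoc, ← leftUnitor_naturality, tmul_whiskerLeft_assoc]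

theorem pairSMul_comp_comp (g : OddHom P y z) (f : OddHom P x y) (e₁ e₂ : K ⟶ P.π) (t : K ⟶ x) :
    pairSMul e₁ e₂ t ≫ g.comp f = g.act e₁ (f.act e₂ t) := by
  rw [OddHom.act_act, pairSMul, Category.assoc]

theorem eq_zero_of_pairSMul_comp [HasBinaryBiproducts C] (T : Tests x) {f : x ⟶ y}
    (h : ∀ (K : C) [ComonObj K] [IsCommComonObj K] (e₁ e₂ : K ⟶ P.π) (t : K ⟶ x), T.mem K t →
      pairSMul e₁ e₂ t ≫ f = 0) : f = 0 :=
  eq_zero_of_pairing (P := P) T fun K _ _ e₁ e₂ t ht => by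
    rw [← h K e₁ e₂ t ht, pairSMul, Category.assoc]

end Pairing

theorem IsNilOp.of_add_self {E : Type*} [CommRing E] (h2 : ∀ t : E, t + t = 0 → t = 0) {n : ℕ}
    {F : AddMonoid.End E} (hF : IsNilOp n (F + F)) : IsNilOp n F := by
  induction n generalizing F with
  | zero =>
    change F = 0
    ext t
    exact h2 _ (DFunLike.congr_fun (show F + F = 0 from hF) t)
  | succ n ih => exact fun b => ih (by rw [← adMul_add]; exact hF b)

variable [TensorCocomplete C] {A : C} {br : OddHom P (A ⊗ A) A} {δ : OddHom P A (A ⊗ A)}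
  {B D : OddHom P (SymObj A) (SymObj A)}

section Elements

variable {K : C} [ComonObj K] [IsCommComonObj K] (e₁ e₂ : K ⟶ P.π)

/-- Since the parameters anticommute, twice the composite is a commutator of two operators of order
`2`, hence of order `3`. -/
theorem isNilOp_bracket_comp (h2 : ∀ t : K ⟶ SymObj A, t + t = 0 → t = 0)
    (hB : IsBracketExtension br B) : IsNilOp 4 (B.op e₁ * B.op e₂) := by
  apply IsNilOp.of_add_self h2
  have : B.op e₁ * B.op e₂ + B.op e₁ * B.op e₂ = B.op e₁ * B.op e₂ - B.op e₂ * B.op e₁ := by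
    ext t
    change B.act e₁ (B.act e₂ t) + B.act e₁ (B.act e₂ t) =
      B.act e₁ (B.act e₂ t) - B.act e₂ (B.act e₁ t)
    rw [OddHom.act_act_swap B B e₁ e₂, sub_neg_eq_add]
  rw [this]
  exact (hB.isNilOp e₁).commutator (hB.isNilOp e₂) (by norm_num)

theorem isNilOp_cobracket_comp (h2 : ∀ t : K ⟶ SymObj A, t + t = 0 → t = 0)
    (hD : IsCobracketExtension δ D) : IsNilOp 2 (D.op e₁ * D.op e₂) := by
  apply IsNilOp.of_add_self h2
  have : D.op e₁ * D.op e₂ + D.op e₁ * D.op e₂ = D.op e₁ * D.op e₂ - D.op e₂ * D.op e₁ := by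
    ext t
    change D.act e₁ (D.act e₂ t) + D.act e₁ (D.act e₂ t) =
      D.act e₁ (D.act e₂ t) - D.act e₂ (D.act e₁ t)
    rw [OddHom.act_act_swap D D e₁ e₂, sub_neg_eq_add]
  rw [this]
  exact (hD.isNilOp e₁).commutator (hD.isNilOp e₂) (by norm_num)

theorem isNilOp_mixed (hB : IsBracketExtension br B) (hD : IsCobracketExtension δ D) :
    IsNilOp 3 (B.op e₁ * D.op e₂ + D.op e₁ * B.op e₂) := by
  have : B.op e₁ * D.op e₂ + D.op e₁ * B.op e₂ = B.op e₁ * D.op e₂ - D.op e₂ * B.op e₁ := by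
    ext t
    change B.act e₁ (D.act e₂ t) + D.act e₁ (B.act e₂ t) =
      B.act e₁ (D.act e₂ t) - D.act e₂ (B.act e₁ t)
    rw [OddHom.act_act_swap D B e₁ e₂, sub_neg_eq_add]
  rw [this]
  exact (hB.isNilOp e₁).commutator (hD.isNilOp e₂) (by norm_num)

variable (x y z : K ⟶ A)

theorem cobracket_symm (hδ : IsSymmCobracket δ) (e : K ⟶ P.π) (x : K ⟶ A) :
    δ.act e x ≫ (β_ A A).hom = δ.act e x := by
  rw [← OddHom.act_postcomp, hδ]

/-- Needed for arbitrary `w`, because it is applied to values of `δ`, which need not be pure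
tensors. Proving it first as an equality of maps reduces it to pure tensors. -/
theorem act_genMul_cobracket (hD : IsCobracketExtension δ D) (e : K ⟶ P.π) (w : K ⟶ A ⊗ A) :
    D.act e (w ≫ genMul A) =
      ((δ.tensorId A).act e w + (δ.tensorId A).act e (w ≫ (β_ A A).hom)) ≫ genMul₃ A := by
  have h : D.precomp (genMul A) = OddHom.postcomp (genMul₃ A) (δ.tensorId A) +
      OddHom.postcomp (genMul₃ A) ((δ.tensorId A).precomp (β_ A A).hom) := by
    apply hom_ext_points₃
    intro L _ _ e x y
    change (D.precomp (genMul A)).act e (x ⊠ y) = OddHom.act (_ + _) e (x ⊠ y)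
    rw [OddHom.act_add, OddHom.act_precomp, OddHom.act_postcomp, OddHom.act_postcomp,
      OddHom.act_precomp, tmul_braiding, OddHom.act_tensorId, OddHom.act_tensorId, tmul_genMul,
      hD.act_mul, hD.act_gen, hD.act_gen, tmul_genMul₃, tmul_genMul₃]
    ring
  rw [← OddHom.act_precomp, h, OddHom.act_add, OddHom.act_postcomp, OddHom.act_postcomp,
    OddHom.act_precomp, Preadditive.add_comp]

theorem act_genMul₃_bracket (hB : IsBracketExtension br B) (e : K ⟶ P.π) (u : K ⟶ (A ⊗ A) ⊗ A) :
    B.act e (u ≫ genMul₃ A) = ((br.tensorId A).act e u + (br.tensorId A).act e (u ≫ swapLast₃ A) +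
      (br.tensorId A).act e (u ≫ (β_ A A).hom ▷ A ≫ swapLast₃ A)) ≫ genMul A := by
  have hs : ∀ (L : C) [ComonObj L] [IsCommComonObj L] (x y z : L ⟶ A),
      (x ⊠ y) ⊠ z ≫ swapLast₃ A = (x ⊠ z) ⊠ y := by
    intro L _ _ x y z
    simp [swapLast₃]
  have h : B.precomp (genMul₃ A) = OddHom.postcomp (genMul A) (br.tensorId A) +
      OddHom.postcomp (genMul A) ((br.tensorId A).precomp (swapLast₃ A)) +
      OddHom.postcomp (genMul A) ((br.tensorId A).precomp ((β_ A A).hom ▷ A ≫ swapLast₃ A)) := by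
    apply hom_ext_points₄
    intro L _ _ e x y z
    change (B.precomp (genMul₃ A)).act e ((x ⊠ y) ⊠ z) = OddHom.act (_ + _ + _) e ((x ⊠ y) ⊠ z)
    rw [OddHom.act_add, OddHom.act_add, OddHom.act_precomp, OddHom.act_postcomp,
      OddHom.act_postcomp, OddHom.act_postcomp, OddHom.act_precomp, OddHom.act_precomp,
      tmul_whiskerRight_assoc, tmul_braiding, hs, hs, OddHom.act_tensorId, OddHom.act_tensorId,
      OddHom.act_tensorId, tmul_genMul₃, tmul_genMul, tmul_genMul, tmul_genMul, tmul_genMul,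
      hB.act_gen_mul_gen_mul_gen]
  rw [← OddHom.act_precomp, h, OddHom.act_add, OddHom.act_add, OddHom.act_postcomp,
    OddHom.act_postcomp, OddHom.act_postcomp, OddHom.act_precomp, OddHom.act_precomp,
    Preadditive.add_comp, Preadditive.add_comp]

theorem cobracket_cobracket (hδ : IsSymmCobracket δ) (hD : IsCobracketExtension δ D) :
    D.act e₁ (D.act e₂ (x ≫ gen A)) =
      pairSMul e₁ e₂ x ≫ ((δ.tensorId A).comp δ ≫ genMul₃ A + (δ.tensorId A).comp δ ≫ genMul₃ A) := by
  rw [hD.act_gen, act_genMul_cobracket hD, cobracket_symm hδ, Preadditive.comp_add,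
    ← Category.assoc, pairSMul_comp_comp, Preadditive.add_comp]

theorem bracket_cobracket_gen (hB : IsBracketExtension br B) (hD : IsCobracketExtension δ D) :
    B.act e₁ (D.act e₂ (x ≫ gen A)) = pairSMul e₁ e₂ x ≫ br.comp δ ≫ gen A := by
  rw [hD.act_gen, hB.act_genMul, ← Category.assoc, pairSMul_comp_comp]

/-- The left hand side of the compatibility condition of the bracket and the cobracket. -/
abbrev cocycleDefect (br : OddHom P (A ⊗ A) A) (δ : OddHom P A (A ⊗ A)) : A ⊗ A ⟶ A ⊗ A :=
  δ.comp br + symm₂ A ≫ ((br.tensorId A).precomp (swapLast₃ A)).comp (δ.tensorId A) ≫ symm₂ A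

theorem symm₂_genMul : symm₂ A ≫ genMul A = genMul A + genMul A := by
  rw [symm₂, Preadditive.add_comp, Category.id_comp, braiding_genMul]

/-- In `B (δ (x) y)` the bracket meets three pairs of factors. One pair gives `br ∘ δ = 0`, and the
other two agree by symmetry of `δ`. The resulting factor `2` is the one that the outer `symm₂`
acquires in `S^2 A` by `symm₂_genMul`. -/
theorem mixed_gen_mul_gen (hδ : IsSymmCobracket δ) (hB : IsBracketExtension br B)
    (hD : IsCobracketExtension δ D) (hinv : br.comp δ = 0) :
    B.act e₁ (D.act e₂ ((x ≫ gen A) * (y ≫ gen A))) +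
      D.act e₁ (B.act e₂ ((x ≫ gen A) * (y ≫ gen A))) =
    pairSMul e₁ e₂ (x ⊠ y) ≫ cocycleDefect br δ ≫ genMul A := by
  have hinv' (x : K ⟶ A) : br.act e₁ (δ.act e₂ x) = 0 := by
    rw [← pairSMul_comp_comp, hinv, comp_zero]
  have hR : pairSMul e₁ e₂ (x ⊠ y) ≫ cocycleDefect br δ ≫ genMul A =
      (δ.act e₁ (br.act e₂ (x ⊠ y)) +
        (br.tensorId A).act e₁ ((δ.act e₂ x) ⊠ y ≫ swapLast₃ A) +
        (br.tensorId A).act e₁ ((δ.act e₂ x) ⊠ y ≫ swapLast₃ A) +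
        (br.tensorId A).act e₁ ((δ.act e₂ y) ⊠ x ≫ swapLast₃ A) +
        (br.tensorId A).act e₁ ((δ.act e₂ y) ⊠ x ≫ swapLast₃ A)) ≫ genMul A := by
    have hs : pairSMul e₁ e₂ (x ⊠ y) ≫ symm₂ A = pairSMul e₁ e₂ (x ⊠ y) + pairSMul e₁ e₂ (y ⊠ x) := by
      rw [symm₂, Preadditive.comp_add, Category.comp_id, pairSMul_comp, tmul_braiding]
    rw [cocycleDefect, Preadditive.add_comp, Preadditive.comp_add, ← Category.assoc,
      pairSMul_comp_comp]
    simp only [Category.assoc, symm₂_genMul]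
    rw [reassoc_of% hs, Preadditive.add_comp, ← Category.assoc, ← Category.assoc,
      pairSMul_comp_comp, pairSMul_comp_comp, OddHom.act_precomp, OddHom.act_precomp,
      OddHom.act_tensorId, OddHom.act_tensorId]
    simp only [Preadditive.comp_add, Preadditive.add_comp]
    abel
  rw [hR, ← tmul_genMul, act_genMul_cobracket hD, hB.act_genMul, hD.act_gen, tmul_braiding,
    act_genMul₃_bracket hB, OddHom.act_tensorId, OddHom.act_tensorId, map_add,
    OddHom.act_tensorId, OddHom.act_tensorId, hinv', hinv']
  simp only [Preadditive.add_comp, map_add, tmul_whiskerRight_assoc, cobracket_symm hδ, zero_tmul,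
    zero_comp]
  abel

theorem bracket_bracket (hbr : IsSymmBracket br) (hB : IsBracketExtension br B) :
    B.act e₁ (B.act e₂ ((x ≫ gen A) * (y ≫ gen A) * (z ≫ gen A))) =
      pairSMul e₁ e₂ ((x ⊠ y) ⊠ z) ≫ symm₃ A ≫ br.comp (br.tensorId A) ≫ gen A := by
  have hzx : br.act e₂ (z ⊠ x) = br.act e₂ (x ⊠ z) := by
    rw [← tmul_braiding x z, ← OddHom.act_precomp, hbr]
  have hs : pairSMul e₁ e₂ ((x ⊠ y) ⊠ z) ≫ symm₃ A = pairSMul e₁ e₂ ((x ⊠ y) ⊠ z) +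
      pairSMul e₁ e₂ ((y ⊠ z) ⊠ x) + pairSMul e₁ e₂ ((z ⊠ x) ⊠ y) := by
    rw [pairSMul_comp, tmul_symm₃]
    simp only [pairSMul, tmul_add, Preadditive.add_comp]
  rw [hB.act_gen_mul_gen_mul_gen, reassoc_of% hs, ← Category.assoc]
  simp only [Preadditive.add_comp, pairSMul_comp_comp, OddHom.act_tensorId, map_add,
    hB.act_gen_mul_gen, hzx]
  abel

theorem act_add_act_add (t : K ⟶ SymObj A) :
    OddHom.act (P := P) (B + D) e₁ (OddHom.act (P := P) (B + D) e₂ t) =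
      B.act e₁ (B.act e₂ t) + (B.act e₁ (D.act e₂ t) + D.act e₁ (B.act e₂ t)) +
        D.act e₁ (D.act e₂ t) := by
  rw [OddHom.act_add, OddHom.act_add, map_add, map_add]
  abel

end Elements

section Coefficients

/-- The map `genMul₃`, as a map to the third symmetric power. -/
noncomputable def symPowπ₃ (A : C) : (A ⊗ A) ⊗ A ⟶ symPow A 3 :=
  ((λ_ A).inv ▷ A) ▷ A ≫ symPowπ A 3

theorem symPowπ₃_ι : symPowπ₃ A ≫ symι A 3 = genMul₃ A := by
  apply (((Tests.all A).tensor (Tests.all A)).tensor (Tests.all A)).hom_ext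
  rintro K _ _ _ ⟨_, z, ⟨x, y, -, -, rfl⟩, -, rfl⟩
  have h : ((x ⊠ y) ⊠ z) ≫ ((λ_ A).inv ▷ A) ▷ A = ((ε[K] ⊠ x) ⊠ y) ⊠ z := by
    rw [tmul_whiskerRight, tmul_whiskerRight, tmul_eq_leftUnitor_inv]
  rw [symPowπ₃, Category.assoc, reassoc_of% h, tmul_genMul₃, tmul_genMul]
  refine (tmul_inc_succ 2 _ z).trans ?_
  refine (congrArg (fun t => t * (z ≫ gen A)) ((tmul_inc_succ 1 _ y).trans
    (congrArg (fun t => t * (y ≫ gen A)) (tmul_inc_succ 0 _ x)))).trans ?_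
  rw [counit_inc_zero, one_mul]

theorem symm₃_genMul₃ : symm₃ A ≫ genMul₃ A = genMul₃ A + genMul₃ A + genMul₃ A := by
  apply (((Tests.all A).tensor (Tests.all A)).tensor (Tests.all A)).hom_ext
  rintro K _ _ _ ⟨_, z, ⟨x, y, -, -, rfl⟩, -, rfl⟩
  rw [← Category.assoc, tmul_symm₃]
  simp only [Preadditive.add_comp, Preadditive.comp_add, tmul_genMul₃, tmul_genMul]
  ring

instance (n : ℕ) : Mono (symι A n) := by
  classical
  unfold symι SymObj
  infer_instance

/-- Cyclic permutations act trivially on `S^3 A`, so the symmetriser becomes multiplication by `3`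
there. As `S^3 A` is a summand of `S A`, the torsion hypothesis can be applied before including it.
-/
theorem eq_zero_of_comp_symm₃ (h3 : ∀ f : A ⟶ symPow A 3, f + f + f = 0 → f = 0)
    {f : A ⟶ (A ⊗ A) ⊗ A} (hf : f ≫ symm₃ A = 0) : f ≫ genMul₃ A = 0 := by
  have h : f ≫ symPowπ₃ A = 0 := by
    apply h3
    rw [← cancel_mono (symι A 3)]
    simp only [Preadditive.add_comp, Category.assoc, symPowπ₃_ι, zero_comp]
    rw [← Preadditive.comp_add, ← Preadditive.comp_add, ← symm₃_genMul₃, reassoc_of% hf, zero_comp]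
  rw [← symPowπ₃_ι, reassoc_of% h, zero_comp]

end Coefficients

/-- The square of the sum of the extensions of the structure maps of an odd IBL algebra vanishes
if the third symmetric power has no `3`-torsion. -/
theorem comp_self_eq_zero (h2 : ∀ {X Y : C} (t : X ⟶ Y), t + t = 0 → t = 0)
    (h3 : ∀ f : A ⟶ symPow A 3, f + f + f = 0 → f = 0)
    (hB : IsBracketExtension br B) (hD : IsCobracketExtension δ D) (h : IsOddIBL br δ) :
    OddHom.comp (P := P) (B + D) (B + D) = 0 := by
  apply eq_zero_of_pairSMul_comp (P := P) (Tests.sym A)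
  rintro K _ _ e₁ e₂ s ⟨n, hs⟩
  rw [pairSMul_comp_comp, act_add_act_add]
  have hBB : B.act e₁ (B.act e₂ s) = 0 := by
    refine (isNilOp_bracket_comp e₁ e₂ h2 hB).eq_zero_of_monomial (fun m hm t ht => ?_) hs
    change B.act e₁ (B.act e₂ t) = 0
    match m, hm with
    | 0, _ => rw [ht.length_zero, hB.act_one, map_zero]
    | 1, _ =>
      obtain ⟨x, rfl⟩ := ht.length_one
      rw [hB.act_gen, map_zero]
    | 2, _ =>
      obtain ⟨_, ⟨x, rfl⟩, _, ⟨y, rfl⟩, rfl⟩ := ht.length_two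
      rw [hB.act_gen_mul_gen, hB.act_gen]
    | 3, _ =>
      obtain ⟨_, ⟨x, rfl⟩, _, ⟨y, rfl⟩, _, ⟨z, rfl⟩, rfl⟩ := ht.length_three
      rw [bracket_bracket _ _ _ _ _ h.symm_br hB, reassoc_of% h.jacobi, zero_comp, comp_zero]
  have hBD : B.act e₁ (D.act e₂ s) + D.act e₁ (B.act e₂ s) = 0 := by
    refine (isNilOp_mixed e₁ e₂ hB hD).eq_zero_of_monomial (fun m hm t ht => ?_) hs
    change B.act e₁ (D.act e₂ t) + D.act e₁ (B.act e₂ t) = 0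
    match m, hm with
    | 0, _ => rw [ht.length_zero, hB.act_one, hD.act_one, map_zero, map_zero, add_zero]
    | 1, _ =>
      obtain ⟨x, rfl⟩ := ht.length_one
      rw [hB.act_gen, map_zero, add_zero, bracket_cobracket_gen _ _ _ hB hD, h.involutivity,
        zero_comp, comp_zero]
    | 2, _ =>
      obtain ⟨_, ⟨x, rfl⟩, _, ⟨y, rfl⟩, rfl⟩ := ht.length_two
      rw [mixed_gen_mul_gen _ _ _ _ h.symm_δ hB hD h.involutivity, cocycleDefect, h.cocycle,
        zero_comp, comp_zero]
  have hDD : D.act e₁ (D.act e₂ s) = 0 := by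
    refine (isNilOp_cobracket_comp e₁ e₂ h2 hD).eq_zero_of_monomial (fun m hm t ht => ?_) hs
    change D.act e₁ (D.act e₂ t) = 0
    match m, hm with
    | 0, _ => rw [ht.length_zero, hD.act_one, map_zero]
    | 1, _ =>
      obtain ⟨x, rfl⟩ := ht.length_one
      rw [cobracket_cobracket _ _ _ h.symm_δ hD, eq_zero_of_comp_symm₃ h3 h.coJacobi, add_zero,
        comp_zero]
  rw [hBB, hBD, hDD, add_zero, add_zero]

/-- If the square of the sum of the extensions vanishes, the structure maps form an odd IBL
algebra. -/
theorem isOddIBL_of_comp_self (h2 : ∀ {X Y : C} (t : X ⟶ Y), t + t = 0 → t = 0)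
    (hbr : IsSymmBracket br) (hδ : IsSymmCobracket δ)
    (hB : IsBracketExtension br B) (hD : IsCobracketExtension δ D)
    (h : OddHom.comp (P := P) (B + D) (B + D) = 0) : IsOddIBL br δ := by
  obtain ⟨p₁, hp₁, hp₁'⟩ := exists_proj₁ A
  obtain ⟨p₂, hp₂⟩ := exists_proj₂ A
  obtain ⟨p₃, hp₃⟩ := exists_proj₃ A
  have hsq : ∀ (K : C) [ComonObj K] [IsCommComonObj K] (e₁ e₂ : K ⟶ P.π) (s : K ⟶ SymObj A),
      B.act e₁ (B.act e₂ s) + (B.act e₁ (D.act e₂ s) + D.act e₁ (B.act e₂ s)) +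
        D.act e₁ (D.act e₂ s) = 0 := by
    intro K _ _ e₁ e₂ s
    rw [← act_add_act_add, ← pairSMul_comp_comp, h, comp_zero]
  have hgen : br.comp δ ≫ gen A + ((δ.tensorId A).comp δ ≫ genMul₃ A +
      (δ.tensorId A).comp δ ≫ genMul₃ A) = 0 := by
    apply eq_zero_of_pairSMul_comp (P := P) (Tests.all A)
    intro K _ _ e₁ e₂ x _
    rw [Preadditive.comp_add, ← cobracket_cobracket _ _ _ hδ hD, ← bracket_cobracket_gen _ _ _ hB hD,
      ← hsq K e₁ e₂ (x ≫ gen A), hB.act_gen]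
    simp
  -- On a generator the square has components in `S^1 A` and `S^3 A`; `p₁` is the identity on the
  -- first and kills the second.
  have hinv : br.comp δ = 0 := by
    have := congrArg (fun t => t ≫ p₁) hgen
    simpa [Preadditive.add_comp, hp₁, hp₁'] using this
  have hco : (δ.tensorId A).comp δ ≫ genMul₃ A = 0 := by
    rw [hinv, zero_comp, zero_add] at hgen
    exact h2 _ hgen
  have hDD : ∀ (K : C) [ComonObj K] [IsCommComonObj K] (e₁ e₂ : K ⟶ P.π) (n : ℕ)
      (s : K ⟶ SymObj A), IsMonomial (gens A K) n s → D.act e₁ (D.act e₂ s) = 0 := by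
    intro K _ _ e₁ e₂ n s hs
    refine (isNilOp_cobracket_comp e₁ e₂ h2 hD).eq_zero_of_monomial (fun m hm t ht => ?_) hs
    change D.act e₁ (D.act e₂ t) = 0
    match m, hm with
    | 0, _ => rw [ht.length_zero, hD.act_one, map_zero]
    | 1, _ =>
      obtain ⟨x, rfl⟩ := ht.length_one
      rw [cobracket_cobracket _ _ _ hδ hD, hco, add_zero, comp_zero]
  -- On length `2` only the mixed part survives: `DD` is already zero, and `BB` vanishes because `B`
  -- sends `x y` to a generator.
  have hcocycle : cocycleDefect br δ ≫ genMul A = 0 := by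
    apply eq_zero_of_pairSMul_comp (P := P) ((Tests.all A).tensor (Tests.all A))
    rintro K _ _ e₁ e₂ _ ⟨x, y, -, -, rfl⟩
    have hxy := (IsMonomial.one.mul (gen_mem_gens x)).mul (gen_mem_gens y)
    rw [one_mul] at hxy
    rw [← mixed_gen_mul_gen _ _ _ _ hδ hB hD hinv,
      ← hsq K e₁ e₂ ((x ≫ gen A) * (y ≫ gen A)), hDD K e₁ e₂ _ _ hxy,
      hB.act_gen_mul_gen e₂, hB.act_gen]
    simp
  have hσ : symm₂ A ≫ (β_ A A).hom = symm₂ A := by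
    simp [symm₂, Preadditive.add_comp, add_comm]
  have hδ' : (δ : P.π ⊗ A ⟶ A ⊗ A) ≫ (β_ A A).hom = δ := hδ
  have hδσ : δ.comp br ≫ (β_ A A).hom = δ.comp br := by
    simp only [OddHom.comp, Category.assoc, hδ']
  refine ⟨hbr, hδ, ?_, ?_, hinv, ?_⟩
  · have hj : symm₃ A ≫ br.comp (br.tensorId A) ≫ gen A = 0 := by
      apply eq_zero_of_pairSMul_comp (P := P)
        (((Tests.all A).tensor (Tests.all A)).tensor (Tests.all A))
      rintro K _ _ e₁ e₂ _ ⟨_, z, ⟨x, y, -, -, rfl⟩, -, rfl⟩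
      have hxyz := ((IsMonomial.one.mul (gen_mem_gens x)).mul (gen_mem_gens y)).mul (gen_mem_gens z)
      rw [one_mul] at hxyz
      -- On length at most `2` both `BB` and `DD` vanish, hence so does the mixed part. Having order
      -- `2`, it also vanishes on `x y z`, where only `BB` is left.
      have hmix := (isNilOp_mixed e₁ e₂ hB hD).eq_zero_of_monomial (S := gens A K) (k := 2)
        (fun m hm t ht => by
          have h0 : B.act e₁ (B.act e₂ t) = 0 := by
            match m, hm with
            | 0, _ => rw [ht.length_zero, hB.act_one, map_zero]
            | 1, _ =>
              obtain ⟨x, rfl⟩ := ht.length_one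
              rw [hB.act_gen, map_zero]
            | 2, _ =>
              obtain ⟨_, ⟨x, rfl⟩, _, ⟨y, rfl⟩, rfl⟩ := ht.length_two
              rw [hB.act_gen_mul_gen, hB.act_gen]
          have := hsq K e₁ e₂ t
          rw [hDD K e₁ e₂ _ _ ht, h0, zero_add, add_zero] at this
          exact this) hxyz
      have hmix' : B.act e₁ (D.act e₂ ((x ≫ gen A) * (y ≫ gen A) * (z ≫ gen A))) +
        D.act e₁ (B.act e₂ ((x ≫ gen A) * (y ≫ gen A) * (z ≫ gen A))) = 0 := hmix
      have := hsq K e₁ e₂ ((x ≫ gen A) * (y ≫ gen A) * (z ≫ gen A))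
      rwa [hDD K e₁ e₂ _ _ hxyz, hmix', add_zero, add_zero, bracket_bracket _ _ _ _ _ hbr hB] at this
    have := congrArg (fun t => t ≫ p₁) hj
    simpa [hp₁] using this
  · have hsw : (δ.tensorId A).comp δ ≫ (β_ A A).hom ▷ A = (δ.tensorId A).comp δ := by
      have : (δ.tensorId A : P.π ⊗ (A ⊗ A) ⟶ (A ⊗ A) ⊗ A) ≫ (β_ A A).hom ▷ A = δ.tensorId A := by
        rw [OddHom.tensorId, Category.assoc, ← MonoidalCategory.comp_whiskerRight, hδ']
      simp only [OddHom.comp, Category.assoc, this]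
    -- The composite of `genMul₃` and `p₃` starts with `id + σ` on the first two factors, which
    -- doubles a map symmetric in them; the cyclic symmetriser remains.
    have := congrArg (fun t => t ≫ p₃) hco
    simp only [Category.assoc, hp₃, Preadditive.comp_add, Preadditive.add_comp, zero_comp,
      Category.id_comp] at this
    rw [reassoc_of% hsw] at this
    exact h2 _ this
  · have := congrArg (fun t => t ≫ p₂) hcocycle
    simp only [Category.assoc, hp₂, zero_comp] at this
    -- The defect is symmetric, so the `symm₂` produced by `p₂` only doubles it.
    have hc : cocycleDefect br δ ≫ (β_ A A).hom = cocycleDefect br δ := by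
      simp only [cocycleDefect, Preadditive.add_comp, Category.assoc, hσ, hδσ]
    rw [symm₂, Preadditive.comp_add, Category.comp_id, hc] at this
    exact h2 _ this

end Square
end OddIBL

open OddIBL
theorem mainTheorem12 {R : Type*} [CommRing R] (h2 : IsUnit (2 : R))
    {C : Type u} [Category.{v} C] [Preadditive C] [Linear R C]
    [MonoidalCategory C] [MonoidalPreadditive C] [MonoidalLinear R C] [SymmetricCategory C]
    [TensorCocomplete C] (P : ParityStructure C)
    (A : C) (br : OddHom P (A ⊗ A) A) (δ : OddHom P A (A ⊗ A))
    (hbr : IsSymmBracket br) (hδ : IsSymmCobracket δ) :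
    (∃! Dbr : OddHom P (SymObj A) (SymObj A), IsBracketExtension br Dbr) ∧
    (∃! Dδ : OddHom P (SymObj A) (SymObj A), IsCobracketExtension δ Dδ) ∧
    ∀ Dbr Dδ : OddHom P (SymObj A) (SymObj A),
      IsBracketExtension br Dbr → IsCobracketExtension δ Dδ →
      IsOddDiffOp 2 (Dbr + Dδ) ∧
      (OddHom.comp (Dbr + Dδ) (Dbr + Dδ) = 0 → IsOddIBL br δ) ∧
      ((∀ f : A ⟶ symPow A 3, (3 : R) • f = 0 → f = 0) →
        IsOddIBL br δ → OddHom.comp (Dbr + Dδ) (Dbr + Dδ) = 0) := by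
  have h2' : ∀ {X Y : C} (t : X ⟶ Y), t + t = 0 → t = 0 := by
    intro X Y t ht
    rw [← two_smul R t] at ht
    exact (h2.smul_eq_zero).mp ht
  refine ⟨?_, ?_, fun B D hB hD => ⟨?_, fun h => isOddIBL_of_comp_self h2' hbr hδ hB hD h,
    fun h3 h => comp_self_eq_zero h2' (fun f hf => h3 f ?_) hB hD h⟩⟩
  · obtain ⟨B, hB⟩ := exists_isBracketExtension hbr
    exact ⟨B, hB, fun B' hB' => hB'.unique hB⟩
  · obtain ⟨D, hD⟩ := exists_isCobracketExtension δ
    exact ⟨D, hD, fun D' hD' => hD'.unique hD⟩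
  · refine oddTIter_eq_zero (n := 2) (Tests.all _) fun K _ _ e b _ => ?_
    have h : OddHom.op (P := P) (B + D) e = B.op e + D.op e := by
      ext t
      exact OddHom.act_add B D e t
    rw [h]
    exact (hB.isNilOp e).add (hD.isNilOp e).succ b
  · rw [← hf, show (3 : R) = 1 + 1 + 1 by norm_num, add_smul, add_smul, one_smul]
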